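/- A virtual knot is an equivalence class of oriented virtual knot diagrams in the plane, that is, generic closed plane curves whose double points are classical crossings (with over/under information) or virtual crossings, up to the generalized Reidemeister moves (equivalently: up to Reidemeister moves on their Gauss codes). An overpass of a diagram is a subarc that goes over at least one classical crossing but never goes under one (virtual crossings are disregarded); it is maximal if it cannot be made longer. A diagram without classical crossings is counted, by convention, as having exactly one maximal overpass. The first bridge index $b_1(K)$ of a virtual knot $K$ is the minimum number of maximal overpasses over all diagrams representing $K$. The second bridge index $b_2(K)$ is the minimum, over all diagrams representing $K$ that are in general position with respect to the height function $h:\mathbb{R}^2\to\mathbb{R}$, of the number of local maxima of $h$ on the diagram. Theorem. For any positive integers $m\le n$ there is a virtual knot $K$ with $b_1(K)=m$ and $b_2(K)=n$. -/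

import Mathlib

/-! Virtual knots, presented by oriented plane diagrams in general position with respect to the
height function, and their two bridge indices. -/

namespace VirtualKnotTheory

/-- One passage of an oriented knot diagram through a classical (real) crossing: the name of the
crossing, whether the passage is the over one (`true`) or the under one (`false`), and the sign of
the crossing. -/
structure Pass where
  crossing : ℕ
  isOver : Bool
  sign : ℤˣ

/-- A Gauss code: the passages through the classical crossings met while travelling once around the
knot, from some base point. Virtual crossings are not recorded. -/
abbrev GaussCode := List Pass

/-- The crossing `c` does not occur in the word `w`. -/
def Fresh (c : ℕ) (w : GaussCode) : Prop := ∀ p ∈ w, p.crossing ≠ c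

/-- Rename a crossing. -/
def Pass.rename (f : ℕ → ℕ) (p : Pass) : Pass := { p with crossing := f p.crossing }

/-- A two-letter word, read forwards for `e = 1` and backwards for `e = -1`. -/
def duo (e : ℤˣ) (p q : Pass) : GaussCode := if e = 1 then [p, q] else [q, p]

/-- The Reidemeister moves on Gauss codes, together with the change of base point and of the
names of the crossings. Each move may be used in both directions.

In the third move three strands (top, middle, bottom) form a triangle, with the crossings
`a` = top over middle, `b` = top over bottom and `c` = middle over bottom. The unit `t` tells whether
the top strand meets `a` before `b`, `m` whether the middle strand meets `a` before `c`, and `l`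
whether the bottom strand meets `b` before `c`; the unit `d` is the orientation of the plane triangle
`abc`. With `sign = sign of det (over direction, under direction)` the crossings have the signs
`d * t * m`, `d * t * l`, `d * m * l`. The move reverses the order on all three strands. The two
constructors are for the two cyclic orders in which the strands can be travelled. -/
inductive GaussMove : GaussCode → GaussCode → Prop
  | rotate (u v : GaussCode) : GaussMove (u ++ v) (v ++ u)
  | rename (f : ℕ → ℕ) (hf : Function.Injective f) (w : GaussCode) :
      GaussMove w (w.map (Pass.rename f))
  | reidemeister₁ (w : GaussCode) (c : ℕ) (hc : Fresh c w) (o : Bool) (s : ℤˣ) :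
      GaussMove w (⟨c, o, s⟩ :: ⟨c, !o, s⟩ :: w)
  | reidemeister₂ (x y : GaussCode) (c c' : ℕ) (hcc' : c ≠ c') (hc : Fresh c (x ++ y))
      (hc' : Fresh c' (x ++ y)) (s e : ℤˣ) :
      GaussMove (x ++ y)
        ([⟨c, true, s⟩, ⟨c', true, -s⟩] ++ x ++ duo e ⟨c, false, s⟩ ⟨c', false, -s⟩ ++ y)
  | reidemeister₃ (x y z : GaussCode) (a b c : ℕ) (d t m l : ℤˣ) :
      GaussMove
        (duo t ⟨a, true, d * t * m⟩ ⟨b, true, d * t * l⟩ ++ x ++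
          duo m ⟨a, false, d * t * m⟩ ⟨c, true, d * m * l⟩ ++ y ++
          duo l ⟨b, false, d * t * l⟩ ⟨c, false, d * m * l⟩ ++ z)
        (duo (-t) ⟨a, true, d * t * m⟩ ⟨b, true, d * t * l⟩ ++ x ++
          duo (-m) ⟨a, false, d * t * m⟩ ⟨c, true, d * m * l⟩ ++ y ++
          duo (-l) ⟨b, false, d * t * l⟩ ⟨c, false, d * m * l⟩ ++ z)
  | reidemeister₃' (x y z : GaussCode) (a b c : ℕ) (d t m l : ℤˣ) :
      GaussMove
        (duo t ⟨a, true, d * t * m⟩ ⟨b, true, d * t * l⟩ ++ x ++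
          duo l ⟨b, false, d * t * l⟩ ⟨c, false, d * m * l⟩ ++ y ++
          duo m ⟨a, false, d * t * m⟩ ⟨c, true, d * m * l⟩ ++ z)
        (duo (-t) ⟨a, true, d * t * m⟩ ⟨b, true, d * t * l⟩ ++ x ++
          duo (-l) ⟨b, false, d * t * l⟩ ⟨c, false, d * m * l⟩ ++ y ++
          duo (-m) ⟨a, false, d * t * m⟩ ⟨c, true, d * m * l⟩ ++ z)

/-- A plane diagram in general position with respect to the height function (critical points and
crossings at different heights) is cut by horizontal lines into slices with one event each. It is
read from the top to the bottom, and the strands that meet a horizontal line are counted from the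
left, starting with `0`.

* `localMax i d`: a local maximum of the height, whose two strands become strands `i` and `i + 1`;
  the left one is oriented downwards if `d = true` and upwards if `d = false`, the right one
  the other way.
* `localMin i`: a local minimum of the height, at which the strands `i` and `i + 1` end.
* `classical i o`: the strands `i` and `i + 1` cross in a classical crossing; the one coming from the
  upper left is the over strand if `o = true` and the under strand if `o = false`.
* `virtual i`: the strands `i` and `i + 1` cross in a virtual crossing. -/
inductive Slice
  | localMax (i : ℕ) (d : Bool)
  | localMin (i : ℕ)
  | classical (i : ℕ) (o : Bool)
  | virtual (i : ℕ)

/-- What has been seen of a diagram above a horizontal line: a family of oriented open arcs, named by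
natural numbers, and of closed components.

* `ends`: for the strands that meet the line, from left to right, the name of the arc
  that the strand belongs to, and its orientation (`true`: downwards, so that it is the
  terminal end of the arc; `false`: upwards, so that it is the initial end of the arc).
* `word a`: the passages through classical crossings along the arc `a`, in order.
* `closed`: the Gauss codes of the closed components. -/
structure Front where
  ends : List (ℕ × Bool)
  word : ℕ → GaussCode
  closed : List GaussCode

/-- The front above the whole diagram. -/
def Front.empty : Front := ⟨[], fun _ => [], []⟩

/-- Lengthen the arc `a` by a passage `p` at its terminal end (`dir = true`) or at its initial end
(`dir = false`). -/
def extend (word : ℕ → GaussCode) (a : ℕ) (dir : Bool) (p : Pass) : ℕ → GaussCode :=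
  Function.update word a (if dir then word a ++ [p] else p :: word a)

/-- The sign of a classical crossing: `o` tells whether the strand from the upper left is the
over strand, `d₁` and `d₂` whether the strands from the upper left and from the upper right are
oriented downwards. If both are oriented downwards (or both upwards), the crossing is positive
exactly if the strand from the upper right is the over strand. -/
def crossingSign (o d₁ d₂ : Bool) : ℤˣ :=
  (if o then -1 else 1) * (if d₁ = d₂ then 1 else -1)

/-- Join the terminal end of the arc `a` to the initial end of the arc `b` at a local minimum, where
`rest` are the strands that remain. If `a = b` this closes up a component. -/
def Front.join (F : Front) (a b : ℕ) (rest : List (ℕ × Bool)) : Front :=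
  if a = b then
    { F with ends := rest, closed := F.word a :: F.closed }
  else
    { F with
      ends := rest.map (fun e => if e.1 = b then (a, e.2) else e)
      word := Function.update F.word a (F.word a ++ F.word b) }

/-- The front below the slice number `k`. New arcs and new crossings are named `k`. The result is
`none` if the slice does not fit: there are not enough strands, or the orientations
of the two strands at a local minimum do not match. -/
def Front.step (k : ℕ) (F : Front) : Slice → Option Front
  | .localMax i d =>
      if i ≤ F.ends.length then
        some { F with
          ends := F.ends.take i ++ (k, d) :: (k, !d) :: F.ends.drop i
          word := Function.update F.word k [] }
      else none
  | .localMin i =>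
      match F.ends.drop i with
      | (a, true) :: (b, false) :: R => some (F.join a b (F.ends.take i ++ R))
      | (b, false) :: (a, true) :: R => some (F.join a b (F.ends.take i ++ R))
      | _ => none
  | .classical i o =>
      match F.ends.drop i with
      | (a, d₁) :: (b, d₂) :: R =>
          some { F with
            ends := F.ends.take i ++ (b, d₂) :: (a, d₁) :: R
            word := extend (extend F.word a d₁ ⟨k, o, crossingSign o d₁ d₂⟩)
              b d₂ ⟨k, !o, crossingSign o d₁ d₂⟩ }
      | _ => none
  | .virtual i =>
      match F.ends.drop i with
      | (a, d₁) :: (b, d₂) :: R =>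
          some { F with ends := F.ends.take i ++ (b, d₂) :: (a, d₁) :: R }
      | _ => none

/-- Sweep a list of slices from the top to the bottom; the first of them has the number `k`. -/
def Front.sweep : ℕ → Front → List Slice → Option Front
  | _, F, [] => some F
  | k, F, s :: S => (F.step k s).bind fun G => Front.sweep (k + 1) G S

/-- An oriented virtual knot diagram in the plane, in general position with respect to the height
function: slices that fit together to a single closed curve, with its Gauss code (which
the slices determine). -/
structure KnotDiagram where
  slices : List Slice
  code : GaussCode
  isKnot : ∃ F, Front.sweep 0 Front.empty slices = some F ∧ F.ends = [] ∧ F.closed = [code]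

/-- Whether a slice is a local maximum of the height function. -/
def Slice.isLocalMax : Slice → Bool
  | .localMax _ _ => true
  | _ => false

/-- The number of local maxima of the height function on a diagram. -/
def KnotDiagram.numLocalMax (D : KnotDiagram) : ℕ := D.slices.countP Slice.isLocalMax

/-- The number of maximal overpasses of a closed curve with the given Gauss code, that is, of maximal
cyclic runs of over passages; each of them starts with an over passage right after an
under passage. By convention, the whole curve counts as one overpass if there is
no classical crossing. -/
def numOverpasses (w : GaussCode) : ℕ :=
  if w.length = 0 then 1
  else (w.zip (w.rotate 1)).countP fun pq => !pq.1.isOver && pq.2.isOver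

/-- Two diagrams represent the same virtual knot if their Gauss codes are related by
Reidemeister moves. -/
instance KnotDiagram.setoid : Setoid KnotDiagram where
  r D D' := Relation.EqvGen GaussMove D.code D'.code
  iseqv := ⟨fun _ => .refl _, fun h => h.symm _ _, fun h h' => h.trans _ _ _ h'⟩

/-- An (oriented) virtual knot: an equivalence class of virtual knot diagrams. -/
def VirtualKnot : Type := Quotient KnotDiagram.setoid

/-- The diagram `D` represents the virtual knot `K`. -/
def KnotDiagram.Represents (D : KnotDiagram) (K : VirtualKnot) : Prop :=
  (Quotient.mk KnotDiagram.setoid D : VirtualKnot) = K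

/-- The first bridge index: the minimal number of maximal overpasses of a diagram of `K`. -/
noncomputable def VirtualKnot.firstBridgeIndex (K : VirtualKnot) : ℕ :=
  sInf {k | ∃ D : KnotDiagram, D.Represents K ∧ numOverpasses D.code = k}

/-- The second bridge index: the minimal number of local maxima of the height function on a diagram
of `K`. -/
noncomputable def VirtualKnot.secondBridgeIndex (K : VirtualKnot) : ℕ :=
  sInf {k | ∃ D : KnotDiagram, D.Represents K ∧ D.numLocalMax = k}

end VirtualKnotTheory

namespace VirtualKnotTheory

/-! Both lower bounds come from counting Fox `3`-colourings. At a classical crossing one strand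
acts: it keeps its colour, and the other strand is reflected in it. Ordinarily the over strand acts;
here a rule `P` chooses the acting strand from the index of the crossing, the difference of the
Alexander numberings of its two passages.

The two crossings of a second Reidemeister move have the same index; in a third move the index of
the top/bottom crossing is the sum of the other two. If `P p = P q` forces `P (p + q) = P p`, "acts
on" has no cycle among the three strands, and colourings correspond as in the classical case. So
having at least `N` colourings is invariant (`attains_iff_of_eqvGen`). The constant rule `true` and
the rule `n ≤ 0` both qualify.

If the over strand always acts, the colours of the maximal overpasses determine a colouring
(`encard_colorings_le_numOverpasses`). For any choice of acting strands, sweep downwards: a local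
maximum brings one new colour, a crossing determines the colours below from those above, and a local
minimum only imposes a condition (`KnotDiagram.encard_colorings_le`).

To separate the two bounds, a trivial arc is enlarged by `n - m` over patterns and `m - 1` trefoil
patterns, each with one more local maximum. A trefoil pattern adds one overpass and has indices `0`
and `-1`, so it triples the count for both rules. An over pattern adds no overpass and has indices
`0` and `1`; it triples the count for the rule `n ≤ 0`. The closed diagram realizes both bounds. -/

/-! ### Comparing cardinalities, and runs along a word. -/

theorem encard_le_of_rel {α β : Type*} {s : Set α} {t : Set β} (r : α → β → Prop)
    (hex : ∀ a ∈ s, ∃ b ∈ t, r a b)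
    (hinj : ∀ a ∈ s, ∀ a' ∈ s, ∀ b, r a b → r a' b → a = a') : s.encard ≤ t.encard := by
  classical
  rcases s.eq_empty_or_nonempty with rfl | ⟨a₀, ha₀⟩
  · simp
  obtain ⟨b₀, -, -⟩ := hex a₀ ha₀
  have : Nonempty β := ⟨b₀⟩
  choose! f hf using fun a => (show a ∈ s → ∃ b, b ∈ t ∧ r a b from fun h => by
    obtain ⟨b, hb, hr⟩ := hex a h; exact ⟨b, hb, hr⟩)
  refine Set.encard_le_encard_of_injOn (f := f) (fun a ha => (hf a ha).1) ?_
  intro a ha a' ha' h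
  exact hinj a ha a' ha' (f a) (hf a ha).2 (h ▸ (hf a' ha').2)

/-- Travelling along the word `w`, with a transition relation `R` for every passage, leads from the
state `x` to the state `y`. -/
def Run {S : Type} (R : Pass → S → S → Prop) : GaussCode → S → S → Prop
  | [], x, y => x = y
  | p :: w, x, y => ∃ z, R p x z ∧ Run R w z y

section Run

variable {S : Type} {R R' : Pass → S → S → Prop}

@[simp] theorem run_nil {x y : S} : Run R [] x y ↔ x = y := Iff.rfl

theorem run_cons {p : Pass} {w : GaussCode} {x y : S} :
    Run R (p :: w) x y ↔ ∃ z, R p x z ∧ Run R w z y := Iff.rfl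

theorem run_append {u v : GaussCode} {x y : S} :
    Run R (u ++ v) x y ↔ ∃ z, Run R u x z ∧ Run R v z y := by
  induction u generalizing x with
  | nil => simp
  | cons p u ih =>
    simp only [List.cons_append, run_cons, ih]
    constructor
    · rintro ⟨z, h, z', h', h''⟩; exact ⟨z', ⟨z, h, h'⟩, h''⟩
    · rintro ⟨z', ⟨z, h, h'⟩, h''⟩; exact ⟨z, h, z', h', h''⟩

theorem run_congr {w : GaussCode} (h : ∀ p ∈ w, R p = R' p) {x y : S} :
    Run R w x y ↔ Run R' w x y := by
  induction w generalizing x with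
  | nil => rfl
  | cons p w ih =>
    simp only [run_cons, h p (by simp), ih fun q hq => h q (by simp [hq])]

theorem run_map {f : Pass → Pass} {w : GaussCode} {x y : S} :
    Run R (w.map f) x y ↔ Run (fun p => R (f p)) w x y := by
  induction w generalizing x with
  | nil => rfl
  | cons p w ih => simp only [List.map_cons, run_cons, ih]

theorem run_right_unique (hR : ∀ p x y y', R p x y → R p x y' → y = y') {w : GaussCode} {x y y' : S}
    (h : Run R w x y) (h' : Run R w x y') : y = y' := by
  induction w generalizing x with
  | nil => exact h.symm.trans h'
  | cons p w ih =>
    obtain ⟨z, hz, h⟩ := h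
    obtain ⟨z', hz', h'⟩ := h'
    obtain rfl := hR _ _ _ _ hz hz'
    exact ih h h'

theorem run_left_unique (hR : ∀ p x x' y, R p x y → R p x' y → x = x') {w : GaussCode} {x x' y : S}
    (h : Run R w x y) (h' : Run R w x' y) : x = x' := by
  induction w generalizing x x' with
  | nil => exact Eq.trans h h'.symm
  | cons p w ih =>
    obtain ⟨z, hz, h⟩ := h
    obtain ⟨z', hz', h'⟩ := h'
    obtain rfl := ih h h'
    exact hR _ _ _ _ hz hz'

/-- Replacing three pieces `A`, `B`, `C` of a word simultaneously. -/
theorem run_replace₃ {A A' B B' C C' x y z : GaussCode}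
    (hR : ∀ p ∈ x ++ y ++ z, R p = R' p)
    (h : ∀ i i' j j' k k', Run R A i i' ∧ Run R B j j' ∧ Run R C k k' →
      Run R' A' i i' ∧ Run R' B' j j' ∧ Run R' C' k k') {u v : S}
    (hw : Run R (A ++ x ++ B ++ y ++ C ++ z) u v) :
    Run R' (A' ++ x ++ B' ++ y ++ C' ++ z) u v := by
  simp only [run_append] at hw ⊢
  obtain ⟨k', ⟨k, ⟨j', ⟨j, ⟨i', hA, hx⟩, hB⟩, hy⟩, hC⟩, hz⟩ := hw
  obtain ⟨hA', hB', hC'⟩ := h _ _ _ _ _ _ ⟨hA, hB, hC⟩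
  exact ⟨k', ⟨k, ⟨j', ⟨j, ⟨i', hA', (run_congr fun p hp => hR p (by simp [hp])).1 hx⟩, hB'⟩,
    (run_congr fun p hp => hR p (by simp [hp])).1 hy⟩, hC'⟩,
    (run_congr fun p hp => hR p (by simp [hp])).1 hz⟩

end Run

/-! ### Levels, indices, colourings and paired Gauss codes. -/

/-- The change of the level (the Alexander numbering) at a passage; `ho` records the level right after
the over passage and `hu` the level right before the under passage of each crossing. -/
def levelStep (ho hu : ℕ → ℤ) (p : Pass) (h h' : ℤ) : Prop :=
  if p.isOver then h' = h + p.sign ∧ ho p.crossing = h' else h' = h - p.sign ∧ hu p.crossing = h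

/-- `δ` assigns to each crossing of the closed word `w` its index: the difference of the levels of its
two passages. -/
def IsIndex (w : GaussCode) (δ : ℕ → ℤ) : Prop :=
  ∃ ho hu : ℕ → ℤ, ∃ h, Run (levelStep ho hu) w h h ∧ ∀ c, δ c = hu c - ho c

/-- The change of a Fox `3`-colour at a passage. The strand that acts at the crossing `c` is the over
strand exactly if `actor c`; it keeps its colour, and this is `γ c`. The other
strand is reflected in `γ c`. -/
def colorStep (actor : ℕ → Bool) (γ : ℕ → ZMod 3) (p : Pass) (x y : ZMod 3) : Prop :=
  if p.isOver = actor p.crossing then x = γ p.crossing ∧ y = x else y = -γ p.crossing - x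

/-- An acting strand keeps its colour and a reflection is an involution. Hence colours can be traced
backwards as well as forwards. -/
theorem colorStep_comm {actor : ℕ → Bool} {γ : ℕ → ZMod 3} {p : Pass} {x y : ZMod 3} :
    colorStep actor γ p x y ↔ colorStep actor γ p y x := by
  unfold colorStep
  split_ifs <;> grind

theorem colorStep_right_unique {actor : ℕ → Bool} {γ : ℕ → ZMod 3} (p : Pass) (x y y' : ZMod 3)
    (h : colorStep actor γ p x y) (h' : colorStep actor γ p x y') : y = y' := by
  unfold colorStep at h h'
  split_ifs at h h' <;> grind

theorem colorStep_left_unique {actor : ℕ → Bool} {γ : ℕ → ZMod 3} (p : Pass) (x x' y : ZMod 3)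
    (h : colorStep actor γ p x y) (h' : colorStep actor γ p x' y) : x = x' :=
  colorStep_right_unique p y x x' (colorStep_comm.1 h) (colorStep_comm.1 h')

theorem colorStep_congr {actor actor' : ℕ → Bool} {γ γ' : ℕ → ZMod 3} {p : Pass}
    (ha : actor p.crossing = actor' p.crossing) (hγ : γ p.crossing = γ' p.crossing) :
    colorStep actor γ p = colorStep actor' γ' p := by
  unfold colorStep
  rw [ha, hγ]

theorem levelStep_congr {ho ho' hu hu' : ℕ → ℤ} {p : Pass}
    (ho_eq : ho p.crossing = ho' p.crossing) (hu_eq : hu p.crossing = hu' p.crossing) :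
    levelStep ho hu p = levelStep ho' hu' p := by
  unfold levelStep
  rw [ho_eq, hu_eq]

/-- The colourings of the closed word `w`: the colour at the base point and the colours of
the acting strands at the crossings. -/
def colorings (actor : ℕ → Bool) (w : GaussCode) : Set (ZMod 3 × (ℕ → ZMod 3)) :=
  {q | Run (colorStep actor q.2) w q.1 q.1 ∧ ∀ c, Fresh c w → q.2 c = 0}

theorem colorings_congr {actor actor' : ℕ → Bool} {w : GaussCode}
    (h : ∀ p ∈ w, actor p.crossing = actor' p.crossing) :
    colorings actor w = colorings actor' w := by
  ext q
  simp only [colorings, Set.mem_ofPred_eq]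
  rw [run_congr fun p hp => colorStep_congr (h p hp) rfl]

theorem fresh_congr {u v : GaussCode} (h : u.Perm v) {c : ℕ} : Fresh c u ↔ Fresh c v := by
  simp only [Fresh, h.mem_iff]

theorem fresh_append {u v : GaussCode} {c : ℕ} : Fresh c (u ++ v) ↔ Fresh c u ∧ Fresh c v := by
  simp only [Fresh, List.mem_append, or_imp, forall_and]

theorem fresh_cons {p : Pass} {v : GaussCode} {c : ℕ} :
    Fresh c (p :: v) ↔ p.crossing ≠ c ∧ Fresh c v := by
  simp [Fresh]

/-- Every crossing that occurs in `w` is passed exactly once over and once under. -/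
def IsPaired (w : GaussCode) : Prop :=
  ∀ c, w.countP (fun p => p.crossing = c ∧ p.isOver = true) =
      w.countP (fun p => p.crossing = c ∧ p.isOver = false) ∧
    w.countP (fun p => p.crossing = c ∧ p.isOver = true) ≤ 1

theorem isPaired_congr {u v : GaussCode} (h : u.Perm v) : IsPaired u ↔ IsPaired v := by
  simp only [IsPaired, h.countP_eq]

theorem fresh_iff_countP {w : GaussCode} {c : ℕ} :
    Fresh c w ↔ w.countP (fun p => p.crossing = c ∧ p.isOver = true) = 0 ∧
      w.countP (fun p => p.crossing = c ∧ p.isOver = false) = 0 := by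
  simp only [Fresh, List.countP_eq_zero, decide_eq_true_eq]
  constructor
  · intro h; exact ⟨fun p hp hh => h p hp hh.1, fun p hp hh => h p hp hh.1⟩
  · rintro ⟨h, h'⟩ p hp hc
    cases ho : p.isOver
    · exact h' p hp ⟨hc, ho⟩
    · exact h p hp ⟨hc, ho⟩

/-- Adding a new pair of passages to a word. -/
theorem isPaired_pair {w : GaussCode} {c : ℕ} (hc : Fresh c w) (o : Bool) (s s' : ℤˣ) :
    IsPaired (⟨c, o, s⟩ :: ⟨c, !o, s'⟩ :: w) ↔ IsPaired w := by
  rw [fresh_iff_countP] at hc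
  unfold IsPaired
  refine forall_congr' fun k => ?_
  simp only [List.countP_cons]
  by_cases hk : c = k
  · subst hk
    simp only [hc.1, hc.2]
    cases o <;> simp
  · simp [hk]

theorem IsPaired.exists_over {w : GaussCode} (h : IsPaired w) {p : Pass} (hp : p ∈ w) (o : Bool) :
    ∃ q ∈ w, q.crossing = p.crossing ∧ q.isOver = o := by
  by_contra! hq
  obtain ⟨h1, -⟩ := h p.crossing
  have hz : w.countP (fun q => q.crossing = p.crossing ∧ q.isOver = o) = 0 := by
    simp only [List.countP_eq_zero, decide_eq_true_eq, not_and]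
    exact fun q hq' hc => hq q hq' hc
  have : Fresh p.crossing w := fresh_iff_countP.2 (by cases o <;> omega)
  exact this p hp rfl

theorem duo_perm (e : ℤˣ) (p q : Pass) : (duo e p q).Perm [p, q] := by
  unfold duo
  split_ifs
  · rfl
  · exact List.Perm.swap _ _ _

/-! ### Invariance under the Reidemeister moves. -/

/-- The word `w` has at least `N` colourings in which the over strand acts exactly at the
crossings whose index satisfies `P`. -/
def Attains (P : ℤ → Bool) (N : ℕ∞) (w : GaussCode) : Prop :=
  IsPaired w ∧ ∃ δ, IsIndex w δ ∧ N ≤ (colorings (fun c => P (δ c)) w).encard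

section Invariance

variable {P : ℤ → Bool} {N : ℕ∞}

/-- The colours at the crossings stay; the new base colour is the colour reached after `u`. Running
along `v` recovers the old one from it. -/
theorem encard_colorings_append_le (actor : ℕ → Bool) (u v : GaussCode) :
    (colorings actor (u ++ v)).encard ≤ (colorings actor (v ++ u)).encard := by
  refine encard_le_of_rel
    (fun q q' => q'.2 = q.2 ∧ Run (colorStep actor q.2) v q'.1 q.1) ?_ ?_
  · rintro ⟨x, γ⟩ ⟨h, h0⟩
    obtain ⟨z, hu, hv⟩ := run_append.1 h
    exact ⟨(z, γ), ⟨run_append.2 ⟨x, hv, hu⟩,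
      fun c hc => h0 c ((fresh_congr List.perm_append_comm).1 hc)⟩, rfl, hv⟩
  · rintro ⟨x, γ⟩ - ⟨x', γ'⟩ - ⟨z, η⟩ ⟨rfl, h⟩ ⟨h', h''⟩
    dsimp only at h h' h''
    subst h'
    rw [run_right_unique colorStep_right_unique h h'']

theorem encard_colorings_append_comm (actor : ℕ → Bool) (u v : GaussCode) :
    (colorings actor (u ++ v)).encard = (colorings actor (v ++ u)).encard :=
  le_antisymm (encard_colorings_append_le _ _ _) (encard_colorings_append_le _ _ _)

theorem Attains.rotate {u v : GaussCode} (h : Attains P N (u ++ v)) : Attains P N (v ++ u) := by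
  obtain ⟨hp, δ, ⟨ho, hu, k, hr, hδ⟩, hN⟩ := h
  obtain ⟨z, h1, h2⟩ := run_append.1 hr
  exact ⟨(isPaired_congr List.perm_append_comm).1 hp, δ,
    ⟨ho, hu, z, run_append.2 ⟨k, h2, h1⟩, hδ⟩, (encard_colorings_append_comm _ u v) ▸ hN⟩

theorem fresh_map_rename {f : ℕ → ℕ} (hf : f.Injective) {w : GaussCode} {c : ℕ} :
    Fresh (f c) (w.map (Pass.rename f)) ↔ Fresh c w := by
  simp [Fresh, Pass.rename, hf.eq_iff]

theorem isPaired_map_rename {f : ℕ → ℕ} (hf : f.Injective) {w : GaussCode} :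
    IsPaired (w.map (Pass.rename f)) ↔ IsPaired w := by
  constructor
  · intro h c
    have := h (f c)
    simpa [List.countP_map, Function.comp_def, Pass.rename, hf.eq_iff] using this
  · intro h c
    by_cases hc : ∃ k, f k = c
    · obtain ⟨k, rfl⟩ := hc
      simpa [List.countP_map, Function.comp_def, Pass.rename, hf.eq_iff] using h k
    · have : Fresh c (w.map (Pass.rename f)) := by
        intro p hp
        obtain ⟨q, -, rfl⟩ := List.mem_map.1 hp
        exact fun h => hc ⟨_, h⟩
      rw [fresh_iff_countP] at this
      omega

theorem encard_colorings_map_rename (actor : ℕ → Bool) {f : ℕ → ℕ} (hf : f.Injective)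
    (w : GaussCode) : (colorings actor (w.map (Pass.rename f))).encard =
      (colorings (fun c => actor (f c)) w).encard := by
  apply le_antisymm
  · refine encard_le_of_rel (fun q q' => q'.1 = q.1 ∧ ∀ c, q'.2 c = q.2 (f c)) ?_ ?_
    · rintro ⟨x, γ⟩ ⟨h, h0⟩
      exact ⟨(x, fun c => γ (f c)),
        ⟨(run_map (f := Pass.rename f)).1 h, fun c hc => h0 _ ((fresh_map_rename hf).2 hc)⟩,
        rfl, fun _ => rfl⟩
    · rintro ⟨x, γ⟩ ⟨-, h⟩ ⟨x', γ'⟩ ⟨-, h'⟩ ⟨z, η⟩ ⟨rfl, h1⟩ ⟨rfl, h2⟩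
      dsimp only at h h' h1 h2
      congr 1
      funext c
      by_cases hc : ∃ k, f k = c
      · obtain ⟨k, rfl⟩ := hc
        rw [← h1, ← h2]
      · have : Fresh c (w.map (Pass.rename f)) := by
          intro p hp
          obtain ⟨q, -, rfl⟩ := List.mem_map.1 hp
          exact fun h => hc ⟨_, h⟩
        rw [h c this, h' c this]
  · refine encard_le_of_rel (fun q q' => q'.1 = q.1 ∧ ∀ c, q'.2 (f c) = q.2 c) ?_ ?_
    · rintro ⟨x, γ⟩ ⟨h, h0⟩
      -- Crossings outside the range of `f` are fresh in the renamed word, so they need the default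
      -- colour `0`.
      refine ⟨(x, Function.extend f γ 0), ⟨run_map.2 ?_, ?_⟩, rfl, fun c => hf.extend_apply _ _ _⟩
      · refine (run_congr fun p _ => ?_).1 h
        funext a b
        simp only [colorStep, Pass.rename, hf.extend_apply]
      · intro c hc
        by_cases hk : ∃ k, f k = c
        · obtain ⟨k, rfl⟩ := hk
          dsimp only
          rw [hf.extend_apply]
          exact h0 k ((fresh_map_rename hf).1 hc)
        · simp [Function.extend_apply' _ _ _ hk]
    · rintro ⟨x, γ⟩ - ⟨x', γ'⟩ - ⟨z, η⟩ ⟨rfl, h1⟩ ⟨rfl, h2⟩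
      congr 1
      funext c
      exact (h1 c).symm.trans (h2 c)

theorem attains_map_rename {f : ℕ → ℕ} (hf : f.Injective) {w : GaussCode} :
    Attains P N (w.map (Pass.rename f)) ↔ Attains P N w := by
  refine and_congr (isPaired_map_rename hf) ⟨?_, ?_⟩
  · rintro ⟨δ, ⟨ho, hu, k, hr, hδ⟩, hN⟩
    refine ⟨fun c => δ (f c), ⟨fun c => ho (f c), fun c => hu (f c), k,
      (run_map (f := Pass.rename f)).1 hr,
      fun c => hδ _⟩, ?_⟩
    rwa [encard_colorings_map_rename _ hf] at hN
  · rintro ⟨δ, ⟨ho, hu, k, hr, hδ⟩, hN⟩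
    refine ⟨Function.extend f δ 0, ⟨Function.extend f ho 0, Function.extend f hu 0, k,
      run_map.2 ((run_congr fun p _ => ?_).1 hr), fun c => ?_⟩, ?_⟩
    · funext a b
      simp only [levelStep, Pass.rename, hf.extend_apply]
    · by_cases hk : ∃ k, f k = c
      · obtain ⟨k, rfl⟩ := hk
        simp only [hf.extend_apply, hδ]
      · simp [Function.extend_apply' _ _ _ hk]
    · rw [encard_colorings_map_rename _ hf]
      simpa only [hf.extend_apply] using hN

/-- A colour whose reflection in `g` is `g` equals `g`. So, in either order of the passages, the
acting one forces `γ c` to be the incoming colour, and the reflection is trivial. -/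
theorem run_colorStep_kink {actor : ℕ → Bool} {γ : ℕ → ZMod 3} {w : GaussCode} {c : ℕ} {o : Bool}
    {s : ℤˣ} {x y : ZMod 3} :
    Run (colorStep actor γ) (⟨c, o, s⟩ :: ⟨c, !o, s⟩ :: w) x y ↔
      γ c = x ∧ Run (colorStep actor γ) w x y := by
  have key : ∀ z z', colorStep actor γ ⟨c, o, s⟩ x z ∧ colorStep actor γ ⟨c, !o, s⟩ z z' ↔
      γ c = x ∧ z = x ∧ z' = x := by
    intro z z'
    unfold colorStep
    generalize γ c = g
    cases o <;> cases actor c <;> simp <;> revert g x z z' <;> decide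
  simp only [run_cons]
  constructor
  · rintro ⟨z, h1, z', h2, h3⟩
    obtain ⟨rfl, rfl, rfl⟩ := (key z z').1 ⟨h1, h2⟩
    exact ⟨rfl, h3⟩
  · rintro ⟨h, h3⟩
    obtain ⟨h1, h2⟩ := (key x x).2 ⟨h, rfl, rfl⟩
    exact ⟨x, h1, x, h2, h3⟩

theorem run_colorStep_congr_fresh {actor : ℕ → Bool} {γ γ' : ℕ → ZMod 3} {w : GaussCode}
    (h : ∀ k, ¬ Fresh k w → γ k = γ' k) {x y : ZMod 3} :
    Run (colorStep actor γ) w x y ↔ Run (colorStep actor γ') w x y :=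
  run_congr fun p hp => colorStep_congr rfl (h _ fun hf => hf p hp rfl)

theorem run_levelStep_congr_fresh {ho ho' hu hu' : ℕ → ℤ} {w : GaussCode}
    (h : ∀ k, ¬ Fresh k w → ho k = ho' k) (h' : ∀ k, ¬ Fresh k w → hu k = hu' k) {x y : ℤ} :
    Run (levelStep ho hu) w x y ↔ Run (levelStep ho' hu') w x y :=
  run_congr fun p hp => levelStep_congr (h _ fun hf => hf p hp rfl) (h' _ fun hf => hf p hp rfl)

theorem encard_colorings_kink (actor : ℕ → Bool) {w : GaussCode} {c : ℕ} (hc : Fresh c w) (o : Bool)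
    (s : ℤˣ) : (colorings actor (⟨c, o, s⟩ :: ⟨c, !o, s⟩ :: w)).encard =
      (colorings actor w).encard := by
  have agree : ∀ {γ γ' : ℕ → ZMod 3}, (∀ k, k ≠ c → γ k = γ' k) → ∀ {x},
      (Run (colorStep actor γ) w x x ↔ Run (colorStep actor γ') w x x) := fun h x =>
    run_colorStep_congr_fresh fun k hk => h k (by rintro rfl; exact hk hc)
  apply le_antisymm
  · refine encard_le_of_rel (fun q q' => q'.1 = q.1 ∧ ∀ k, k ≠ c → q.2 k = q'.2 k) ?_ ?_
    · rintro ⟨x, γ⟩ ⟨h, h0⟩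
      obtain ⟨-, h⟩ := run_colorStep_kink.1 h
      have ha : ∀ k, k ≠ c → γ k = Function.update γ c 0 k := fun k hk => by simp [hk]
      refine ⟨(x, Function.update γ c 0), ⟨(agree ha).1 h, fun k hk => ?_⟩, rfl, ha⟩
      by_cases hkc : k = c
      · simp [hkc]
      · refine (ha k hkc).symm.trans ?_
        exact h0 k (by simp [fresh_cons, hk, Ne.symm hkc])
    · rintro ⟨x, γ⟩ ⟨h, -⟩ ⟨x', γ'⟩ ⟨h', -⟩ ⟨z, η⟩ ⟨rfl, h1⟩ ⟨rfl, h2⟩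
      congr 1
      funext k
      by_cases hk : k = c
      · subst hk
        exact (run_colorStep_kink.1 h).1.trans (run_colorStep_kink.1 h').1.symm
      · exact (h1 k hk).trans (h2 k hk).symm
  · refine encard_le_of_rel (fun q q' => q'.1 = q.1 ∧ ∀ k, k ≠ c → q.2 k = q'.2 k) ?_ ?_
    · rintro ⟨x, γ⟩ ⟨h, h0⟩
      have ha : ∀ k, k ≠ c → γ k = Function.update γ c x k := fun k hk => by simp [hk]
      refine ⟨(x, Function.update γ c x), ⟨run_colorStep_kink.2 ⟨by simp, (agree ha).1 h⟩,
        fun k hk => ?_⟩, rfl, ha⟩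
      simp only [fresh_cons, ne_eq] at hk
      refine (ha k (Ne.symm hk.1)).symm.trans ?_
      exact h0 k hk.2.2
    · rintro ⟨x, γ⟩ ⟨-, h⟩ ⟨x', γ'⟩ ⟨-, h'⟩ ⟨z, η⟩ ⟨rfl, h1⟩ ⟨rfl, h2⟩
      congr 1
      funext k
      by_cases hk : k = c
      · subst hk
        exact (h k hc).trans (h' k hc).symm
      · exact (h1 k hk).trans (h2 k hk).symm

theorem attains_kink {w : GaussCode} {c : ℕ} (hc : Fresh c w) (o : Bool) (s : ℤˣ) :
    Attains P N (⟨c, o, s⟩ :: ⟨c, !o, s⟩ :: w) ↔ Attains P N w := by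
  refine and_congr (isPaired_pair hc o s s) ⟨?_, ?_⟩
  · rintro ⟨δ, ⟨ho, hu, k, hr, hδ⟩, hN⟩
    rw [encard_colorings_kink _ hc] at hN
    refine ⟨δ, ⟨ho, hu, k, ?_, hδ⟩, hN⟩
    obtain ⟨z, h1, z', h2, h3⟩ := hr
    have : z' = k := by
      cases o <;> simp [levelStep] at h1 h2 <;> omega
    exact this ▸ h3
  · rintro ⟨δ, ⟨ho, hu, k, hr, hδ⟩, hN⟩
    -- The level right after the over passage and that right before the under passage coincide in a
    -- kink, so its crossing has index `0`.
    let l : ℤ := if o then k + s else k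
    refine ⟨Function.update δ c 0, ⟨Function.update ho c l, Function.update hu c l, k, ?_, ?_⟩, ?_⟩
    · have h3 := (run_levelStep_congr_fresh (ho' := Function.update ho c l)
        (hu' := Function.update hu c l)
        (fun j hj => by rw [Function.update_of_ne]; rintro rfl; exact hj hc)
        (fun j hj => by rw [Function.update_of_ne]; rintro rfl; exact hj hc)).1 hr
      refine ⟨if o then k + s else k - s, ?_, k, ?_, h3⟩ <;> cases o <;> simp [levelStep, l]
    · intro j
      by_cases hj : j = c
      · simp [hj]
      · simp [hj, hδ]
    · rw [encard_colorings_kink _ hc]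
      rwa [colorings_congr (actor' := fun c => P (δ c))]
      intro p hp
      rw [Function.update_of_ne (hc p hp)]

theorem run_duo {S : Type} {R : Pass → S → S → Prop} {e : ℤˣ} {p q : Pass} {x y : S} :
    Run R (duo e p q) x y ↔
      if e = 1 then ∃ z, R p x z ∧ R q z y else ∃ z, R q x z ∧ R p z y := by
  unfold duo
  split_ifs <;> simp [run_cons]

/-- The result of the second Reidemeister move. -/
def bigon (x y : GaussCode) (c c' : ℕ) (s e : ℤˣ) : GaussCode :=
  [⟨c, true, s⟩, ⟨c', true, -s⟩] ++ x ++ duo e ⟨c, false, s⟩ ⟨c', false, -s⟩ ++ y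

theorem bigon_perm (x y : GaussCode) (c c' : ℕ) (s e : ℤˣ) : (bigon x y c c' s e).Perm
    (⟨c, true, s⟩ :: ⟨c, !true, s⟩ :: ⟨c', true, -s⟩ :: ⟨c', !true, -s⟩ :: (x ++ y)) := by
  unfold bigon
  refine ((((duo_perm _ _ _).append_left _).append_right _)).trans ?_
  classical
  rw [List.perm_iff_count]
  intro p
  simp only [List.count_append, List.count_cons, List.count_nil, Bool.not_true]
  omega

section Bigon

variable {x y : GaussCode} {c c' : ℕ} {s e : ℤˣ}

theorem fresh_bigon {k : ℕ} : Fresh k (bigon x y c c' s e) ↔ c ≠ k ∧ c' ≠ k ∧ Fresh k (x ++ y) := by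
  rw [fresh_congr (bigon_perm ..)]
  simp only [fresh_cons]
  tauto

theorem isPaired_bigon (hcc' : c ≠ c') (hc : Fresh c (x ++ y)) (hc' : Fresh c' (x ++ y)) :
    IsPaired (bigon x y c c' s e) ↔ IsPaired (x ++ y) := by
  rw [isPaired_congr (bigon_perm ..), isPaired_pair _ _, isPaired_pair hc']
  exact fresh_cons.2 ⟨hcc'.symm, fresh_cons.2 ⟨hcc'.symm, hc⟩⟩

/-- Reflecting twice in one colour is the identity. The incoming colour of the acting strand (`a`
for the over strand, `z` for the under strand) is the colour of both crossings. -/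
theorem run_colorStep_bigon {actor : ℕ → Bool} (h : actor c = actor c') {γ : ℕ → ZMod 3}
    {a b : ZMod 3} :
    Run (colorStep actor γ) (bigon x y c c' s e) a b ↔ ∃ z, Run (colorStep actor γ) x a z ∧
      Run (colorStep actor γ) y z b ∧ γ c = (if actor c then a else z) ∧ γ c' = γ c := by
  have key : ∀ a' z z', (Run (colorStep actor γ) [⟨c, true, s⟩, ⟨c', true, -s⟩] a a' ∧
      Run (colorStep actor γ) (duo e ⟨c, false, s⟩ ⟨c', false, -s⟩) z z') ↔
      a' = a ∧ z' = z ∧ γ c = (if actor c then a else z) ∧ γ c' = γ c := by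
    intro a' z z'
    simp only [run_duo, run_cons, run_nil, colorStep, ← h]
    generalize γ c = g
    generalize γ c' = g'
    cases actor c <;> split_ifs <;> simp <;> grind
  simp only [bigon, run_append]
  constructor
  · rintro ⟨z', ⟨z, ⟨a', h1, h2⟩, h3⟩, h4⟩
    obtain ⟨rfl, rfl, h5⟩ := (key _ _ _).1 ⟨h1, h3⟩
    exact ⟨_, h2, h4, h5⟩
  · rintro ⟨z, h2, h4, h5⟩
    obtain ⟨h1, h3⟩ := (key a z z).2 ⟨rfl, rfl, h5⟩
    exact ⟨z, ⟨z, ⟨a, h1, h2⟩, h3⟩, h4⟩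

theorem encard_colorings_bigon {actor : ℕ → Bool} (h : actor c = actor c')
    (hc : Fresh c (x ++ y)) (hc' : Fresh c' (x ++ y)) :
    (colorings actor (bigon x y c c' s e)).encard = (colorings actor (x ++ y)).encard := by
  have agree : ∀ {γ γ' : ℕ → ZMod 3}, (∀ k, k ≠ c → k ≠ c' → γ k = γ' k) → ∀ w,
      (∀ p ∈ w, p ∈ x ++ y) → ∀ {a b},
      (Run (colorStep actor γ) w a b ↔ Run (colorStep actor γ') w a b) := fun h w hw a b =>
    run_congr fun p hp => colorStep_congr rfl (h _ (hc p (hw p hp)) (hc' p (hw p hp)))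
  have hx : ∀ p ∈ x, p ∈ x ++ y := fun p hp => by simp [hp]
  have hy : ∀ p ∈ y, p ∈ x ++ y := fun p hp => by simp [hp]
  apply le_antisymm
  · refine encard_le_of_rel
      (fun q q' => q'.1 = q.1 ∧ ∀ k, k ≠ c → k ≠ c' → q.2 k = q'.2 k) ?_ ?_
    · rintro ⟨a, γ⟩ ⟨hr, h0⟩
      obtain ⟨z, h1, h2, -⟩ := (run_colorStep_bigon h).1 hr
      have ha : ∀ k, k ≠ c → k ≠ c' → γ k = Function.update (Function.update γ c 0) c' 0 k :=
        fun k hk hk' => by simp [hk, hk']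
      refine ⟨(a, Function.update (Function.update γ c 0) c' 0),
        ⟨run_append.2 ⟨z, (agree ha x hx).1 h1, (agree ha y hy).1 h2⟩, fun k hk => ?_⟩, rfl, ha⟩
      by_cases hk1 : k = c'
      · simp [hk1]
      by_cases hk2 : k = c
      · subst hk2; simp [hk1]
      refine (ha k hk2 hk1).symm.trans ?_
      exact h0 k (fresh_bigon.2 ⟨Ne.symm hk2, Ne.symm hk1, hk⟩)
    · rintro ⟨a, γ⟩ ⟨hr, -⟩ ⟨a', γ'⟩ ⟨hr', -⟩ ⟨z, η⟩ ⟨rfl, h1⟩ ⟨rfl, h2⟩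
      obtain ⟨z, hz, -, h3, h4⟩ := (run_colorStep_bigon h).1 hr
      obtain ⟨z', hz', -, h3', h4'⟩ := (run_colorStep_bigon h).1 hr'
      dsimp only at *
      have h12 : ∀ k, k ≠ c → k ≠ c' → γ k = γ' k := fun k hk hk' =>
        (h1 k hk hk').trans (h2 k hk hk').symm
      have hzz := run_right_unique colorStep_right_unique ((agree h12 x hx).1 hz) hz'
      have hcc : γ c = γ' c := by rw [h3, h3', hzz]
      congr 1
      funext k
      by_cases hk : k = c
      · rw [hk, hcc]
      by_cases hk' : k = c'
      · rw [hk', h4, h4', hcc]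
      exact h12 k hk hk'
  · refine encard_le_of_rel
      (fun q q' => q'.1 = q.1 ∧ ∀ k, k ≠ c → k ≠ c' → q.2 k = q'.2 k) ?_ ?_
    · rintro ⟨a, γ⟩ ⟨hr, h0⟩
      obtain ⟨z, h1, h2⟩ := run_append.1 hr
      set g : ZMod 3 := if actor c then a else z with hg
      have ha : ∀ k, k ≠ c → k ≠ c' → γ k = Function.update (Function.update γ c g) c' g k :=
        fun k hk hk' => by simp [hk, hk']
      have hgc : Function.update (Function.update γ c g) c' g c = g := by
        by_cases hcc : c = c' <;> simp [hcc]
      refine ⟨(a, Function.update (Function.update γ c g) c' g), ⟨(run_colorStep_bigon h).2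
        ⟨z, (agree ha x hx).1 h1, (agree ha y hy).1 h2, hgc, ?_⟩, fun k hk => ?_⟩, rfl, ha⟩
      · exact (Function.update_self _ _ _).trans hgc.symm
      · obtain ⟨hk1, hk2, hk3⟩ := fresh_bigon.1 hk
        refine (ha k hk1.symm hk2.symm).symm.trans ?_
        exact h0 k hk3
    · rintro ⟨a, γ⟩ ⟨-, hr⟩ ⟨a', γ'⟩ ⟨-, hr'⟩ ⟨z, η⟩ ⟨rfl, h1⟩ ⟨rfl, h2⟩
      congr 1
      funext k
      by_cases hk : k = c
      · subst hk; exact (hr _ hc).trans (hr' _ hc).symm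
      by_cases hk' : k = c'
      · subst hk'; exact (hr _ hc').trans (hr' _ hc').symm
      exact (h1 k hk hk').trans (h2 k hk hk').symm

theorem attains_bigon (hcc' : c ≠ c') (hc : Fresh c (x ++ y)) (hc' : Fresh c' (x ++ y)) :
    Attains P N (bigon x y c c' s e) ↔ Attains P N (x ++ y) := by
  refine and_congr (isPaired_bigon hcc' hc hc') ⟨?_, ?_⟩
  · rintro ⟨δ, ⟨ho, hu, k, hr, hδ⟩, hN⟩
    simp only [bigon, run_append] at hr
    obtain ⟨z', ⟨z, ⟨a, h1, h2⟩, h3⟩, h4⟩ := hr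
    simp only [run_duo, run_cons, run_nil, levelStep, Units.val_neg, Bool.false_eq_true, if_true,
      if_false] at h1 h3
    -- The opposite signs cancel on each strand, and the two crossings get the same index, hence the
    -- same acting strand.
    have h5 : a = k ∧ z' = z ∧ δ c = δ c' := by
      rw [hδ, hδ]
      split_ifs at h3 <;> grind
    obtain ⟨rfl, rfl, h5⟩ := h5
    refine ⟨δ, ⟨ho, hu, a, run_append.2 ⟨_, h2, h4⟩, hδ⟩, ?_⟩
    rwa [encard_colorings_bigon (by rw [h5]) hc hc'] at hN
  · rintro ⟨δ, ⟨ho, hu, k, hr, hδ⟩, hN⟩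
    obtain ⟨z, h1, h2⟩ := run_append.1 hr
    -- These values are forced: the over strand enters the bigon at level `k`, the under strand at
    -- level `z`, and `e` tells which crossing the latter meets first.
    let ho' : ℕ → ℤ := Function.update (Function.update ho c (k + s)) c' k
    let hu' : ℕ → ℤ := Function.update (Function.update hu c (if e = 1 then z else z + s)) c'
      (if e = 1 then z - s else z)
    have agree : ∀ w, (∀ p ∈ w, p ∈ x ++ y) → ∀ {a b},
        (Run (levelStep ho hu) w a b ↔ Run (levelStep ho' hu') w a b) := fun w hw a b =>
      run_congr fun p hp => levelStep_congr
        (by simp [ho', hc p (hw p hp), hc' p (hw p hp)])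
        (by simp [hu', hc p (hw p hp), hc' p (hw p hp)])
    refine ⟨fun j => hu' j - ho' j, ⟨ho', hu', k, ?_, fun _ => rfl⟩, ?_⟩
    · simp only [bigon, run_append]
      refine ⟨z, ⟨z, ⟨k, ?_, (agree x fun p hp => by simp [hp]).1 h1⟩, ?_⟩,
        (agree y fun p hp => by simp [hp]).1 h2⟩
      · simp [run_cons, levelStep, ho', hcc']
      · simp only [run_duo, levelStep, hu', Function.update_self, Function.update_of_ne hcc',
          Bool.false_eq_true, if_false]
        split_ifs <;> simp
    · rw [encard_colorings_bigon _ hc hc', colorings_congr (actor' := fun c => P (δ c))]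
      · exact hN
      · intro p hp
        simp [hδ, ho', hu', hc p hp, hc' p hp]
      · simp only [ho', hu', Function.update_self, Function.update_of_ne hcc']
        congr 1
        split_ifs <;> ring

end Bigon

theorem IsPaired.fresh {w : GaussCode} {c : ℕ} {s s' : ℤˣ}
    (h : IsPaired (⟨c, true, s⟩ :: ⟨c, false, s'⟩ :: w)) : Fresh c w := by
  have := h c
  rw [fresh_iff_countP]
  simp only [List.countP_cons, decide_true, and_self, if_true, Bool.true_eq_false,
    Bool.false_eq_true, and_false, decide_false, if_false] at this
  omega

section Triangle

variable {a b c : ℕ} {sa sb sc d t m l : ℤˣ}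

/-- Each crossing is carried across the third strand. Its two recorded levels shift by the same
`±1`, with a sign depending on `d` and the direction of that third strand; hence its index is
unchanged. -/
theorem run_levelStep_triangle {ho hu e : ℕ → ℤ} (hsa : sa = d * t * m) (hsb : sb = d * t * l)
    (hsc : sc = d * m * l) (hea : e a = d * l) (heb : e b = -(d * m)) (hec : e c = d * t)
    {i i' j j' k k' : ℤ}
    (h : Run (levelStep ho hu) (duo t ⟨a, true, sa⟩ ⟨b, true, sb⟩) i i' ∧
      Run (levelStep ho hu) (duo m ⟨a, false, sa⟩ ⟨c, true, sc⟩) j j' ∧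
      Run (levelStep ho hu) (duo l ⟨b, false, sb⟩ ⟨c, false, sc⟩) k k') :
    (hu b - ho b = (hu a - ho a) + (hu c - ho c)) ∧
    Run (levelStep (ho + e) (hu + e)) (duo (-t) ⟨a, true, sa⟩ ⟨b, true, sb⟩) i i' ∧
      Run (levelStep (ho + e) (hu + e)) (duo (-m) ⟨a, false, sa⟩ ⟨c, true, sc⟩) j j' ∧
      Run (levelStep (ho + e) (hu + e)) (duo (-l) ⟨b, false, sb⟩ ⟨c, false, sc⟩) k k' := by
  have hne : (-1 : ℤˣ) ≠ 1 := by decide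
  subst hsa hsb hsc
  rcases Int.units_eq_one_or d with rfl | rfl <;> rcases Int.units_eq_one_or t with rfl | rfl <;>
  rcases Int.units_eq_one_or m with rfl | rfl <;> rcases Int.units_eq_one_or l with rfl | rfl <;>
  · simp only [run_duo, levelStep, Pi.add_apply, hea, heb, hec, if_true, if_false, neg_neg, hne,
      Bool.false_eq_true, Units.val_one, Units.val_neg, mul_one, mul_neg] at h ⊢
    obtain ⟨⟨i₁, ⟨h1, h2⟩, h3, h4⟩, ⟨j₁, ⟨h5, h6⟩, h7, h8⟩, ⟨k₁, ⟨h9, h10⟩, h11, h12⟩⟩ := h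
    refine ⟨by omega, ⟨_, ⟨rfl, ?_⟩, ?_, ?_⟩, ⟨_, ⟨rfl, ?_⟩, ?_, ?_⟩, ⟨_, ⟨rfl, ?_⟩, ?_, ?_⟩⟩ <;>
      omega

theorem run_duo_neg {actor : ℕ → Bool} {γ : ℕ → ZMod 3} {e : ℤˣ} {p q : Pass} {x y : ZMod 3} :
    Run (colorStep actor γ) (duo (-e) p q) x y ↔ Run (colorStep actor γ) (duo e p q) y x := by
  have hne : (-1 : ℤˣ) ≠ 1 := by decide
  rcases Int.units_eq_one_or e with rfl | rfl <;>
    simp only [run_duo, hne, neg_neg, if_true, if_false] <;>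
    simp only [colorStep_comm (x := x), colorStep_comm (y := y)] <;>
    exact exists_congr fun z => and_comm

/-- The change of the colours of the acting strands in the third Reidemeister move. -/
def flipTriangle (actor : ℕ → Bool) (a b c : ℕ) (γ : ℕ → ZMod 3) : ℕ → ZMod 3 :=
  if actor a && actor b then Function.update γ c (-γ a - γ c)
  else if !actor a && actor c then Function.update γ b (-γ a - γ b)
  else Function.update γ a (-γ b - γ a)

theorem flipTriangle_of_ne {actor : ℕ → Bool} {γ : ℕ → ZMod 3} {k : ℕ} (ha : k ≠ a) (hb : k ≠ b)
    (hc : k ≠ c) : flipTriangle actor a b c γ k = γ k := by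
  unfold flipTriangle
  split_ifs <;> simp [*]

/-- The one colour that changes is reflected in a colour that stays, so it can be recovered. -/
theorem flipTriangle_injective (actor : ℕ → Bool) (hab : a ≠ b) (hac : a ≠ c) :
    (flipTriangle actor a b c).Injective := by
  intro γ γ' h
  have aux : ∀ {u v : ℕ}, u ≠ v →
      Function.update γ v (-γ u - γ v) = Function.update γ' v (-γ' u - γ' v) → γ = γ' := by
    intro u v huv h
    have h1 := congrFun h u
    have h2 := congrFun h v
    simp only [Function.update_of_ne huv, Function.update_self] at h1 h2
    funext k
    by_cases hk : k = v
    · subst hk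
      rw [h1] at h2
      exact sub_right_injective h2
    · simpa [hk] using congrFun h k
  unfold flipTriangle at h
  split_ifs at h
  exacts [aux hac h, aux hab h, aux hab.symm h]

/-- By `hacyc` one of the strands acts on both others. The crossing of those two is carried across
it, so the acting colour there is reflected in the colour of the first strand; all other acting
colours stay. -/
theorem run_colorStep_triangle {actor : ℕ → Bool} {γ : ℕ → ZMod 3} (hab : a ≠ b) (hac : a ≠ c)
    (hbc : b ≠ c) (hacyc : actor a = actor c → actor b = actor a) {i i' j j' k k' : ZMod 3}
    (h : Run (colorStep actor γ) (duo t ⟨a, true, sa⟩ ⟨b, true, sb⟩) i i' ∧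
      Run (colorStep actor γ) (duo m ⟨a, false, sa⟩ ⟨c, true, sc⟩) j j' ∧
      Run (colorStep actor γ) (duo l ⟨b, false, sb⟩ ⟨c, false, sc⟩) k k') :
    Run (colorStep actor (flipTriangle actor a b c γ))
        (duo (-t) ⟨a, true, sa⟩ ⟨b, true, sb⟩) i i' ∧
      Run (colorStep actor (flipTriangle actor a b c γ))
        (duo (-m) ⟨a, false, sa⟩ ⟨c, true, sc⟩) j j' ∧
      Run (colorStep actor (flipTriangle actor a b c γ))
        (duo (-l) ⟨b, false, sb⟩ ⟨c, false, sc⟩) k k' := by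
  have key : ∀ {i i' j j' k k' : ZMod 3},
      (Run (colorStep actor γ) (duo 1 ⟨a, true, sa⟩ ⟨b, true, sb⟩) i i' ∧
      Run (colorStep actor γ) (duo 1 ⟨a, false, sa⟩ ⟨c, true, sc⟩) j j' ∧
      Run (colorStep actor γ) (duo 1 ⟨b, false, sb⟩ ⟨c, false, sc⟩) k k') →
      Run (colorStep actor (flipTriangle actor a b c γ))
          (duo (-1) ⟨a, true, sa⟩ ⟨b, true, sb⟩) i i' ∧
        Run (colorStep actor (flipTriangle actor a b c γ))
          (duo (-1) ⟨a, false, sa⟩ ⟨c, true, sc⟩) j j' ∧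
        Run (colorStep actor (flipTriangle actor a b c γ))
          (duo (-1) ⟨b, false, sb⟩ ⟨c, false, sc⟩) k k' := by
    intro i i' j j' k k'
    rw [run_duo_neg, run_duo_neg, run_duo_neg]
    simp only [run_duo, if_true, colorStep, flipTriangle]
    generalize hA : actor a = A at *
    generalize hB : actor b = B at *
    generalize hC : actor c = C at *
    cases A <;> cases B <;> cases C <;> simp at hacyc <;>
      simp [hab, hac, hbc, hab.symm, hac.symm, hbc.symm] <;> grind
  -- Reversing a strand only exchanges the two ends of its run, since the steps are symmetric. So
  -- the eight cases reduce to `key`.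
  rcases Int.units_eq_one_or t with rfl | rfl <;> rcases Int.units_eq_one_or m with rfl | rfl <;>
    rcases Int.units_eq_one_or l with rfl | rfl <;>
    simp only [neg_neg, run_duo_neg (e := 1)] at h key ⊢ <;>
    exact key h

/-- The hypothesis `hrun` hides where the three pieces lie, so one argument serves both cyclic
orders. It is stated for all state types because it is applied to levels and to colours; `Q` exports
the additivity of the indices from the level run. -/
theorem Attains.triangle (hP : ∀ p q, P p = P q → P (p + q) = P p) {w w' r : GaussCode}
    (hsa : sa = d * t * m) (hsb : sb = d * t * l) (hsc : sc = d * m * l)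
    (hw : w.Perm (duo t ⟨a, true, sa⟩ ⟨b, true, sb⟩ ++ duo m ⟨a, false, sa⟩ ⟨c, true, sc⟩ ++
      duo l ⟨b, false, sb⟩ ⟨c, false, sc⟩ ++ r))
    (hww' : w.Perm w')
    (hrun : ∀ (S : Type) (R R' : Pass → S → S → Prop) (Q : Prop), (∀ p ∈ r, R p = R' p) →
      (∀ i i' j j' k k', Run R (duo t ⟨a, true, sa⟩ ⟨b, true, sb⟩) i i' ∧
        Run R (duo m ⟨a, false, sa⟩ ⟨c, true, sc⟩) j j' ∧
        Run R (duo l ⟨b, false, sb⟩ ⟨c, false, sc⟩) k k' →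
        Q ∧ Run R' (duo (-t) ⟨a, true, sa⟩ ⟨b, true, sb⟩) i i' ∧
        Run R' (duo (-m) ⟨a, false, sa⟩ ⟨c, true, sc⟩) j j' ∧
        Run R' (duo (-l) ⟨b, false, sb⟩ ⟨c, false, sc⟩) k k') →
      ∀ u v, Run R w u v → Q ∧ Run R' w' u v)
    (h : Attains P N w) : Attains P N w' := by
  obtain ⟨hp, δ, ⟨ho, hu, h₀, hr, hδ⟩, hN⟩ := h
  have hw' := hw.trans ((((duo_perm t _ _).append (duo_perm m _ _)).append
    (duo_perm l _ _)).append_right r)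
  have hp' := (isPaired_congr hw').1 hp
  -- The move itself allows equal names; two equal names would give one crossing two over passages.
  have distinct : a ≠ b ∧ a ≠ c ∧ b ≠ c := by
    refine ⟨?_, ?_, ?_⟩ <;> rintro rfl
    · have := (hp' a).2
      simp [List.countP_cons] at this
    · have := (hp' a).2
      simp [List.countP_cons] at this
    · have := hp' b
      simp [List.countP_cons] at this
      omega
  obtain ⟨hab, hac, hbc⟩ := distinct
  have fresh_r : Fresh a r ∧ Fresh b r ∧ Fresh c r := by
    have aux : ∀ {k s s'} {v : GaussCode}, [⟨a, true, sa⟩, ⟨b, true, sb⟩, ⟨a, false, sa⟩,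
        ⟨c, true, sc⟩, ⟨b, false, sb⟩, ⟨c, false, sc⟩].Perm (⟨k, true, s⟩ :: ⟨k, false, s'⟩ :: v) →
        Fresh k r := fun h =>
      (fresh_append.1 ((isPaired_congr (h.append_right r)).1 hp').fresh).2
    refine ⟨aux (s := sa) (s' := sa)
        (v := [⟨b, true, sb⟩, ⟨c, true, sc⟩, ⟨b, false, sb⟩, ⟨c, false, sc⟩]) ?_,
      aux (s := sb) (s' := sb)
        (v := [⟨a, true, sa⟩, ⟨a, false, sa⟩, ⟨c, true, sc⟩, ⟨c, false, sc⟩]) ?_,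
      aux (s := sc) (s' := sc)
        (v := [⟨a, true, sa⟩, ⟨b, true, sb⟩, ⟨a, false, sa⟩, ⟨b, false, sb⟩]) ?_⟩ <;>
    · classical
      rw [List.perm_iff_count]
      intro p
      simp only [List.count_cons, List.count_nil]
      omega
  obtain ⟨hra, hrb, hrc⟩ := fresh_r
  have not_fresh : ¬ Fresh a w ∧ ¬ Fresh b w ∧ ¬ Fresh c w := by
    simp only [fresh_congr hw', fresh_append, fresh_cons]
    tauto
  let e : ℕ → ℤ := fun k => if k = a then d * l else if k = b then -(d * m) else
    if k = c then d * t else 0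
  have hea : e a = d * l := by simp [e]
  have heb : e b = -(d * m) := by simp [e, hab.symm]
  have hec : e c = d * t := by simp [e, hac.symm, hbc.symm]
  obtain ⟨hadd, hrun'⟩ := hrun ℤ (levelStep ho hu) (levelStep (ho + e) (hu + e))
    (hu b - ho b = (hu a - ho a) + (hu c - ho c)) (fun p hp => by
      have h0 : e p.crossing = 0 := by simp [e, hra p hp, hrb p hp, hrc p hp]
      exact levelStep_congr (by simp [h0]) (by simp [h0]))
    (fun _ _ _ _ _ _ h => run_levelStep_triangle hsa hsb hsc hea heb hec h) _ _ hr
  refine ⟨(isPaired_congr hww').1 hp, δ, ⟨_, _, h₀, hrun', fun k => ?_⟩, hN.trans ?_⟩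
  · rw [hδ, Pi.add_apply, Pi.add_apply]; ring
  · set actor : ℕ → Bool := fun k => P (δ k) with hactor
    -- The index of `b` is the sum of those of `a` and `c`, so the condition on `P` excludes a cycle
    -- of acting strands.
    have hacyc : actor a = actor c → actor b = actor a := by
      intro hac'
      simp only [hactor, hδ b, hadd, ← hδ] at hac' ⊢
      exact hP _ _ hac'
    refine Set.encard_le_encard_of_injOn (f := fun q => (q.1, flipTriangle actor a b c q.2)) ?_ ?_
    · rintro ⟨x, γ⟩ ⟨h1, h2⟩
      refine ⟨(hrun _ _ _ True (fun p hp => ?_) (fun _ _ _ _ _ _ h =>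
        ⟨trivial, run_colorStep_triangle hab hac hbc hacyc h⟩) _ _ h1).2, fun k hk => ?_⟩
      · exact colorStep_congr rfl (flipTriangle_of_ne (hra p hp) (hrb p hp) (hrc p hp)).symm
      · rw [← fresh_congr hww'] at hk
        refine (flipTriangle_of_ne ?_ ?_ ?_).trans (h2 k hk) <;> rintro rfl <;> tauto
    · rintro ⟨x, γ⟩ - ⟨x', γ'⟩ - h
      simp only [Prod.mk.injEq] at h
      rw [h.1, flipTriangle_injective actor hab hac h.2]

theorem Attains.reidemeister₃ (hP : ∀ p q, P p = P q → P (p + q) = P p) {x y z : GaussCode}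
    (hsa : sa = d * t * m) (hsb : sb = d * t * l) (hsc : sc = d * m * l)
    (h : Attains P N (duo t ⟨a, true, sa⟩ ⟨b, true, sb⟩ ++ x ++
      duo m ⟨a, false, sa⟩ ⟨c, true, sc⟩ ++ y ++ duo l ⟨b, false, sb⟩ ⟨c, false, sc⟩ ++ z)) :
    Attains P N (duo (-t) ⟨a, true, sa⟩ ⟨b, true, sb⟩ ++ x ++
      duo (-m) ⟨a, false, sa⟩ ⟨c, true, sc⟩ ++ y ++
      duo (-l) ⟨b, false, sb⟩ ⟨c, false, sc⟩ ++ z) := by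
  refine h.triangle (a := a) (b := b) (c := c) hP (r := x ++ y ++ z) hsa hsb hsc ?_ ?_ ?_
  · classical
    rw [List.perm_iff_count]
    intro p
    simp only [List.count_append]
    omega
  · refine (((((List.Perm.append ?_ .rfl).append ?_).append .rfl).append ?_).append .rfl) <;>
      exact (duo_perm ..).trans (duo_perm ..).symm
  · intro S R R' Q hR hloc u v hr
    have hQ : Q := by
      simp only [run_append] at hr
      obtain ⟨k', ⟨k, ⟨j', ⟨j, ⟨i', hA, hx⟩, hB⟩, hy⟩, hC⟩, hz⟩ := hr
      exact (hloc _ _ _ _ _ _ ⟨hA, hB, hC⟩).1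
    exact ⟨hQ, run_replace₃ hR (fun _ _ _ _ _ _ h => (hloc _ _ _ _ _ _ h).2) hr⟩

theorem Attains.reidemeister₃' (hP : ∀ p q, P p = P q → P (p + q) = P p) {x y z : GaussCode}
    (hsa : sa = d * t * m) (hsb : sb = d * t * l) (hsc : sc = d * m * l)
    (h : Attains P N (duo t ⟨a, true, sa⟩ ⟨b, true, sb⟩ ++ x ++
      duo l ⟨b, false, sb⟩ ⟨c, false, sc⟩ ++ y ++ duo m ⟨a, false, sa⟩ ⟨c, true, sc⟩ ++ z)) :
    Attains P N (duo (-t) ⟨a, true, sa⟩ ⟨b, true, sb⟩ ++ x ++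
      duo (-l) ⟨b, false, sb⟩ ⟨c, false, sc⟩ ++ y ++
      duo (-m) ⟨a, false, sa⟩ ⟨c, true, sc⟩ ++ z) := by
  refine h.triangle (a := a) (b := b) (c := c) hP (r := x ++ y ++ z) hsa hsb hsc ?_ ?_ ?_
  · classical
    rw [List.perm_iff_count]
    intro p
    simp only [List.count_append]
    omega
  · refine (((((List.Perm.append ?_ .rfl).append ?_).append .rfl).append ?_).append .rfl) <;>
      exact (duo_perm ..).trans (duo_perm ..).symm
  · intro S R R' Q hR hloc u v hr
    have hQ : Q := by
      simp only [run_append] at hr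
      obtain ⟨k', ⟨k, ⟨j', ⟨j, ⟨i', hA, hx⟩, hB⟩, hy⟩, hC⟩, hz⟩ := hr
      exact (hloc _ _ _ _ _ _ ⟨hA, hC, hB⟩).1
    refine ⟨hQ, run_replace₃ hR (fun _ _ _ _ _ _ h => ?_) hr⟩
    obtain ⟨-, h1, h2, h3⟩ := hloc _ _ _ _ _ _ ⟨h.1, h.2.2, h.2.1⟩
    exact ⟨h1, h3, h2⟩

end Triangle

theorem GaussMove.attains_iff (hP : ∀ p q, P p = P q → P (p + q) = P p) {w w' : GaussCode}
    (h : GaussMove w w') : Attains P N w ↔ Attains P N w' := by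
  cases h with
  | rotate u v => exact ⟨Attains.rotate, Attains.rotate⟩
  | rename f hf w => exact (attains_map_rename hf).symm
  | reidemeister₁ w c hc o s => exact (attains_kink hc o s).symm
  | reidemeister₂ x y c c' hcc' hc hc' s e => exact (attains_bigon hcc' hc hc').symm
  | reidemeister₃ x y z a b c d t m l =>
    refine ⟨fun h => h.reidemeister₃ hP rfl rfl rfl, fun h => ?_⟩
    -- Negating `t`, `m`, `l` while keeping `d` preserves all crossing signs, so the inverse move is
    -- an instance of the same move.
    simpa only [neg_neg] using h.reidemeister₃ (d := d) hP (by simp) (by simp) (by simp)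
  | reidemeister₃' x y z a b c d t m l =>
    refine ⟨fun h => h.reidemeister₃' hP rfl rfl rfl, fun h => ?_⟩
    simpa only [neg_neg] using h.reidemeister₃' (d := d) hP (by simp) (by simp) (by simp)

theorem attains_iff_of_eqvGen (hP : ∀ p q, P p = P q → P (p + q) = P p) {w w' : GaussCode}
    (h : Relation.EqvGen GaussMove w w') : Attains P N w ↔ Attains P N w' := by
  induction h with
  | rel _ _ h => exact h.attains_iff hP
  | refl => rfl
  | symm _ _ _ ih => exact ih.symm
  | trans _ _ _ _ _ ih ih' => exact ih.trans ih'

end Invariance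

/-! ### Overpasses bound the ordinary colourings. -/

/-- The number of times that `true` comes right after `false` in a list, where `prev` is the entry
before the list. -/
def ascents : Bool → List Bool → ℕ
  | _, [] => 0
  | prev, b :: l => (if !prev && b then 1 else 0) + ascents b l

theorem ascents_append_true (prev : Bool) (l l' : List Bool) :
    ascents prev (l ++ true :: l') = ascents prev (l ++ [true]) + ascents true l' := by
  induction l generalizing prev with
  | nil => simp [ascents]
  | cons b l ih => simp only [List.cons_append, ascents, ih]; ring

theorem numOverpasses_cons (p : Pass) (w : GaussCode) :
    numOverpasses (p :: w) = ascents p.isOver ((w ++ [p]).map Pass.isOver) := by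
  have key : ∀ (w : GaussCode) (p q : Pass),
      ((p :: w).zip (w ++ [q])).countP (fun pq => !pq.1.isOver && pq.2.isOver) =
        ascents p.isOver ((w ++ [q]).map Pass.isOver) := by
    intro w
    induction w with
    | nil => intro p q; simp [ascents, List.countP_cons]
    | cons r w ih =>
      intro p q
      rw [List.cons_append, List.zip_cons_cons, List.countP_cons, ih]
      simp only [List.map_cons, ascents]
      ring
  unfold numOverpasses
  rw [if_neg (by simp), List.rotate_cons_succ, List.rotate_zero, key]

theorem numOverpasses_append_comm (u v : GaussCode) :
    numOverpasses (u ++ v) = numOverpasses (v ++ u) := by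
  unfold numOverpasses
  rw [← List.rotate_append_length_eq u v]
  simp only [List.length_rotate]
  congr 1
  have hzip : ∀ (l l' : GaussCode) (n : ℕ), l.length = l'.length →
      (l.rotate n).zip (l'.rotate n) = (l.zip l').rotate n := fun l l' n h => by
    simpa only [List.zip_eq_zipWith] using (List.zipWith_rotate_distrib Prod.mk l l' n h).symm
  rw [List.rotate_rotate, Nat.add_comm, ← List.rotate_rotate, hzip _ _ _ (by simp)]
  exact ((List.rotate_perm _ _).countP_eq _).symm

/-- The crossings at which the maximal overpasses of a word start, where `prev` tells whether the
passage before the word is an over passage. -/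
def overpassStarts : Bool → GaussCode → List ℕ
  | _, [] => []
  | prev, p :: w =>
    (if !prev && p.isOver then [p.crossing] else []) ++ overpassStarts p.isOver w

theorem length_overpassStarts (prev : Bool) (w : GaussCode) :
    (overpassStarts prev w).length = ascents prev (w.map Pass.isOver) := by
  induction w generalizing prev with
  | nil => rfl
  | cons p w ih =>
    simp only [overpassStarts, List.length_append, ih, List.map_cons, ascents]
    split_ifs <;> rfl

/-- The colour is constant along an overpass, so agreement at its first crossing spreads to all of
it. Agreement of the incoming colours matters only if the word begins in the middle of an overpass.
-/
theorem eq_at_over_passes {γ γ' : ℕ → ZMod 3} {w : GaussCode} {prev : Bool} {x x' y y' : ZMod 3}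
    (h : Run (colorStep (fun _ => true) γ) w x y) (h' : Run (colorStep (fun _ => true) γ') w x' y')
    (hx : prev = true → x = x') (hs : ∀ c ∈ overpassStarts prev w, γ c = γ' c) :
    ∀ p ∈ w, p.isOver = true → γ p.crossing = γ' p.crossing := by
  induction w generalizing prev x x' with
  | nil => simp
  | cons q w ih =>
    obtain ⟨z, hz, h⟩ := h
    obtain ⟨z', hz', h'⟩ := h'
    have htail : ∀ c ∈ overpassStarts q.isOver w, γ c = γ' c := fun c hc =>
      hs c (by simp [overpassStarts, hc])
    unfold colorStep at hz hz'
    by_cases hq : q.isOver = true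
    · rw [if_pos hq] at hz hz'
      have hγ : γ q.crossing = γ' q.crossing := by
        cases prev
        · exact hs _ (by simp [overpassStarts, hq])
        · rw [← hz.1, ← hz'.1, hx rfl]
      intro p hp hpo
      rcases List.mem_cons.1 hp with rfl | hp
      · exact hγ
      · exact ih h h' (fun _ => by rw [hz.2, hz'.2, hz.1, hz'.1, hγ]) htail p hp hpo
    · intro p hp hpo
      rcases List.mem_cons.1 hp with rfl | hp
      · exact absurd hpo hq
      · exact ih h h' (fun h => absurd h hq) htail p hp hpo

theorem encard_le_three_pow {α : Type*} {s : Set α} {k : ℕ} (f : α → Fin k → ZMod 3)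
    (hf : s.InjOn f) : s.encard ≤ 3 ^ k := by
  refine (Set.encard_le_encard_of_injOn (t := Set.univ) (fun _ _ => Set.mem_univ _) hf).trans ?_
  rw [Set.encard_univ, ENat.card_eq_coe_fintype_card]
  simp [ZMod.card]

theorem encard_colorings_le_numOverpasses {w : GaussCode} (hw : IsPaired w) :
    (colorings (fun _ => true) w).encard ≤ 3 ^ numOverpasses w := by
  rcases w with _ | ⟨p₀, w₀⟩
  · refine encard_le_three_pow (fun q _ => q.1) ?_
    rintro ⟨x, γ⟩ ⟨-, h⟩ ⟨x', γ'⟩ ⟨-, h'⟩ hx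
    have hx : x = x' := congrFun hx ⟨0, by simp [numOverpasses]⟩
    have hγ : γ = γ' := funext fun c => (h c (by simp [Fresh])).trans (h' c (by simp [Fresh])).symm
    rw [hx, hγ]
  -- With the base point right after an under passage, no overpass is cut and `overpassStarts false`
  -- lists them all.
  · obtain ⟨p, hp, -, hpu⟩ := hw.exists_over (List.mem_cons_self (a := p₀) (l := w₀)) false
    obtain ⟨u, v, huv⟩ := List.append_of_mem hp
    rw [huv] at hw ⊢
    have hassoc : u ++ p :: v = (u ++ [p]) ++ v := by simp
    rw [numOverpasses_append_comm, hassoc, encard_colorings_append_comm, List.cons_append,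
      numOverpasses_cons, hpu]
    replace hw : IsPaired (v ++ (u ++ [p])) :=
      (isPaired_congr (hassoc ▸ List.perm_append_comm)).1 hw
    rw [← List.append_assoc] at hw ⊢
    generalize hW : v ++ u ++ [p] = W at hw
    have hpW : p ∈ W := by simp [← hW]
    rw [← length_overpassStarts]
    refine encard_le_three_pow (fun q i => q.2 ((overpassStarts false W).get i)) ?_
    rintro ⟨x, γ⟩ ⟨h, h0⟩ ⟨x', γ'⟩ ⟨h', h0'⟩ hq
    have hstarts : ∀ c ∈ overpassStarts false W, γ c = γ' c := by
      intro c hc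
      obtain ⟨i, rfl⟩ := List.get_of_mem hc
      exact congrFun hq i
    have hover := eq_at_over_passes h h' (by simp) hstarts
    have hγ : γ = γ' := by
      funext c
      by_cases hc : Fresh c W
      · exact (h0 c hc).trans (h0' c hc).symm
      · simp only [Fresh, not_forall, not_not] at hc
        obtain ⟨r, hr, rfl⟩ := hc
        obtain ⟨r', hr', hrr, ho⟩ := hw.exists_over hr true
        rw [← hrr]
        exact hover r' hr' ho
    subst hγ
    -- At an over passage the colour of the run is known from `γ`; tracing it back gives the base
    -- colour.
    obtain ⟨r, hr, -, hro⟩ := hw.exists_over hpW true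
    obtain ⟨s, s', rfl⟩ := List.append_of_mem hr
    obtain ⟨z, hz, z₁, h1, -⟩ := run_append.1 h
    obtain ⟨z', hz', z₁', h1', -⟩ := run_append.1 h'
    unfold colorStep at h1 h1'
    rw [if_pos hro] at h1 h1'
    obtain rfl : z = z' := h1.1.trans h1'.1.symm
    rw [show x = x' from run_left_unique colorStep_left_unique hz hz']

/-! ### Local maxima bound the colourings for every choice of acting strands. -/

/-- The bookkeeping facts about the front `F` above the slice number `k`, where `C` is the set of the
crossings that have been seen. -/
structure Front.IsSound (k : ℕ) (C : Set ℕ) (F : Front) : Prop where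
  nodup : F.ends.Nodup
  opposite : ∀ a d, (a, d) ∈ F.ends → (a, !d) ∈ F.ends
  name_lt : ∀ e ∈ F.ends, e.1 < k
  word_mem : ∀ e ∈ F.ends, ∀ p ∈ F.word e.1, p.crossing ∈ C
  closed_mem : ∀ w ∈ F.closed, ∀ p ∈ w, p.crossing ∈ C
  crossing_lt : ∀ c ∈ C, c < k

/-- The colourings of the arcs and closed components of a front, seen through the colours of the
acting strands at the crossings, of the strands that meet the line, and of the
base points of the closed components. -/
def Front.colorings (actor : ℕ → Bool) (C : Set ℕ) (F : Front) :
    Set ((ℕ → ZMod 3) × List (ZMod 3) × List (ZMod 3)) :=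
  {o | (∃ κ : ℕ × Bool → ZMod 3, (∀ e ∈ F.ends,
      Run (colorStep actor o.1) (F.word e.1) (κ (e.1, false)) (κ (e.1, true))) ∧
      o.2.1 = F.ends.map κ) ∧
    List.Forall₂ (fun w x => Run (colorStep actor o.1) w x x) F.closed o.2.2 ∧
    ∀ c ∉ C, o.1 c = 0}

section Sweep

variable {actor : ℕ → Bool} {k i : ℕ} {C : Set ℕ} {F G : Front}

/-- The two new strands are the ends of an empty arc and share one colour. This colour is the only
new freedom. -/
theorem Front.step_localMax (hF : F.IsSound k C) {d : Bool}
    (h : F.step k (.localMax i d) = some G) :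
    G.IsSound (k + 1) C ∧
      (G.colorings actor C).encard ≤ 3 * (F.colorings actor C).encard := by
  simp only [Front.step, Option.ite_none_right_eq_some, Option.some.injEq] at h
  obtain ⟨hi, rfl⟩ := h
  have hperm : (F.ends.take i ++ (k, d) :: (k, !d) :: F.ends.drop i).Perm
      ((k, d) :: (k, !d) :: F.ends) := by
    conv_rhs => rw [← List.take_append_drop i F.ends]
    exact List.perm_middle.trans ((List.perm_middle).cons _)
  have hne : ∀ e ∈ F.ends, e.1 ≠ k := fun e he => (hF.name_lt e he).ne
  have hword : ∀ e ∈ F.ends, Function.update F.word k [] e.1 = F.word e.1 := fun e he =>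
    Function.update_of_ne (hne e he) _ _
  refine ⟨⟨?_, ?_, ?_, ?_, hF.closed_mem, fun c hc => (hF.crossing_lt c hc).trans k.lt_succ_self⟩, ?_⟩
  · rw [hperm.nodup_iff]
    simp only [List.nodup_cons, List.mem_cons, not_or]
    refine ⟨⟨by simp, fun h => hne _ h rfl⟩, fun h => hne _ h rfl, hF.nodup⟩
  · intro a e
    simp only [hperm.mem_iff, List.mem_cons, Prod.mk.injEq]
    rintro (⟨rfl, rfl⟩ | ⟨rfl, rfl⟩ | h)
    · simp
    · simp
    · exact Or.inr (Or.inr (hF.opposite a e h))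
  · intro e
    simp only [hperm.mem_iff, List.mem_cons]
    rintro (rfl | rfl | h)
    · simp
    · simp
    · exact (hF.name_lt e h).trans k.lt_succ_self
  · intro e
    simp only [hperm.mem_iff, List.mem_cons]
    rintro (rfl | rfl | h)
    · simp
    · simp
    · rw [hword e h]
      exact hF.word_mem e h
  · have h3 : (3 : ℕ∞) * (F.colorings actor C).encard =
        ((Set.univ : Set (ZMod 3)) ×ˢ F.colorings actor C).encard := by
      rw [Set.encard_prod, Set.encard_univ, ENat.card_eq_coe_fintype_card, ZMod.card]
      rfl
    rw [h3]
    refine encard_le_of_rel (fun o q => o.1 = q.2.1 ∧ o.2.2 = q.2.2.2 ∧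
      o.2.1 = q.2.2.1.take i ++ q.1 :: q.1 :: q.2.2.1.drop i) ?_ ?_
    · rintro ⟨γ, cols, χ⟩ ⟨⟨κ, hκ, hcols⟩, hχ, hγ⟩
      dsimp only at *
      have hk := hκ (k, d) (hperm.mem_iff.2 (by simp))
      simp only [Function.update_self, run_nil] at hk
      refine ⟨(κ (k, false), γ, F.ends.map κ, χ), ⟨Set.mem_univ _, ⟨κ, fun e he => ?_, rfl⟩, hχ, hγ⟩,
        rfl, rfl, ?_⟩
      · rw [← hword e he]
        exact hκ e (hperm.mem_iff.2 (by simp [he]))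
      · rw [hcols]
        cases d <;> simp [hk]
    · rintro ⟨γ, cols, χ⟩ - ⟨γ', cols', χ'⟩ - ⟨x, γ'', cols'', χ''⟩ ⟨h1, h2, h3⟩ ⟨h4, h5, h6⟩
      dsimp only at *
      rw [h1, h2, h3, h4, h5, h6]

theorem eq_take_append_of_drop_eq {α : Type*} {l : List α} {i : ℕ} {x : α} {r : List α}
    (h : l.drop i = x :: r) : l = l.take i ++ x :: r ∧ (l.take i).length = i := by
  refine ⟨by rw [← h, List.take_append_drop], ?_⟩
  rw [List.length_take, min_eq_left]
  by_contra! hi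
  rw [List.drop_eq_nil_of_le hi.le] at h
  simp at h

theorem Front.step_virtual (hF : F.IsSound k C) (h : F.step k (.virtual i) = some G) :
    G.IsSound (k + 1) C ∧
      (G.colorings actor C).encard ≤ (F.colorings actor C).encard := by
  simp only [Front.step] at h
  split at h
  · rename_i a d₁ b d₂ R hdrop
    simp only [Option.some.injEq] at h
    subst h
    obtain ⟨hE, hlen⟩ := eq_take_append_of_drop_eq hdrop
    generalize F.ends.take i = L at hE hlen ⊢
    have hperm : (L ++ (b, d₂) :: (a, d₁) :: R).Perm F.ends :=
      hE ▸ (List.Perm.swap _ _ _).append_left L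
    refine ⟨⟨hperm.nodup_iff.2 hF.nodup, ?_, ?_, ?_, hF.closed_mem,
      fun c hc => (hF.crossing_lt c hc).trans k.lt_succ_self⟩, ?_⟩
    · simpa only [hperm.mem_iff] using hF.opposite
    · simpa only [hperm.mem_iff] using fun e he => (hF.name_lt e he).trans k.lt_succ_self
    · simpa only [hperm.mem_iff] using hF.word_mem
    · refine encard_le_of_rel (fun o q => o.1 = q.1 ∧ o.2.2 = q.2.2 ∧ ∃ L' x y R',
        L'.length = i ∧ q.2.1 = L' ++ x :: y :: R' ∧ o.2.1 = L' ++ y :: x :: R') ?_ ?_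
      · rintro ⟨γ, cols, χ⟩ ⟨⟨κ, hκ, hcols⟩, hχ, hγ⟩
        refine ⟨(γ, F.ends.map κ, χ), ⟨⟨κ, fun e he => hκ e (hperm.mem_iff.2 he), rfl⟩, hχ, hγ⟩,
          rfl, rfl, L.map κ, κ (a, d₁), κ (b, d₂), R.map κ, by simp [hlen], by simp [hE], ?_⟩
        rw [hcols]
        simp
      · rintro ⟨γ, cols, χ⟩ - ⟨γ', cols', χ'⟩ - ⟨γ'', cols'', χ''⟩
          ⟨h1, h2, L₁, x₁, y₁, R₁, h3, h4, h5⟩ ⟨h1', h2', L₂, x₂, y₂, R₂, h3', h4', h5'⟩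
        dsimp only at *
        obtain ⟨rfl, h6⟩ := List.append_inj (h4.symm.trans h4') (h3.trans h3'.symm)
        simp only [List.cons.injEq] at h6
        rw [h1, h1', h2, h2', h5, h5', h6.1, h6.2.1, h6.2.2]
  · simp at h

/-- Undoing the extension of an arc in a colouring. -/
theorem run_of_extend {R : Pass → ZMod 3 → ZMod 3 → Prop} (hR : ∀ p x y, R p x y → R p y x)
    {word : ℕ → GaussCode} {a : ℕ} {d : Bool} {p : Pass} {κ : ℕ × Bool → ZMod 3} {A : Set ℕ}
    (ha : a ∈ A)
    (h : ∀ n ∈ A, Run R (extend word a d p n) (κ (n, false)) (κ (n, true))) :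
    ∃ x, R p x (κ (a, d)) ∧ ∀ n ∈ A,
      Run R (word n) (Function.update κ (a, d) x (n, false)) (Function.update κ (a, d) x (n, true)) := by
  have key : ∃ x, R p x (κ (a, d)) ∧
      Run R (word a) (Function.update κ (a, d) x (a, false)) (Function.update κ (a, d) x (a, true)) := by
    have hk := h a ha
    simp only [extend, Function.update_self] at hk
    cases d
    · simp only [Bool.false_eq_true, if_false] at hk
      obtain ⟨x, h1, h2⟩ := hk
      exact ⟨x, hR _ _ _ h1, by simpa using h2⟩
    · simp only [if_true] at hk
      obtain ⟨x, h1, y, h2, rfl⟩ := run_append.1 hk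
      exact ⟨x, h2, by simpa using h1⟩
  obtain ⟨x, hx, hrun⟩ := key
  refine ⟨x, hx, fun n hn => ?_⟩
  by_cases hna : n = a
  · subst hna
    exact hrun
  · have := h n hn
    simpa [extend, hna] using this

/-- The colours above determine everything below: the acting strand keeps its colour, which is also
the colour of the crossing `k`, and the other strand is reflected in it. -/
theorem Front.step_classical (hF : F.IsSound k C) {o : Bool}
    (h : F.step k (.classical i o) = some G) :
    G.IsSound (k + 1) (insert k C) ∧
      (G.colorings actor (insert k C)).encard ≤ (F.colorings actor C).encard := by
  simp only [Front.step] at h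
  split at h
  · rename_i a d₁ b d₂ R hdrop
    simp only [Option.some.injEq] at h
    subst h
    obtain ⟨hE, hlen⟩ := eq_take_append_of_drop_eq hdrop
    generalize F.ends.take i = L at hE hlen ⊢
    have hperm : (L ++ (b, d₂) :: (a, d₁) :: R).Perm F.ends :=
      hE ▸ (List.Perm.swap _ _ _).append_left L
    generalize crossingSign o d₁ d₂ = s
    have hkC : k ∉ C := fun hk => (hF.crossing_lt k hk).false
    have haF : (a, d₁) ∈ F.ends := by rw [hE]; simp
    have hbF : (b, d₂) ∈ F.ends := by rw [hE]; simp
    have hne : (a, d₁) ≠ (b, d₂) := by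
      have := hF.nodup
      rw [hE, List.nodup_append] at this
      have := this.2.1
      simp only [List.nodup_cons, List.mem_cons, not_or] at this
      exact this.1.1
    have hLR : ∀ e ∈ L ++ R, e ≠ (a, d₁) ∧ e ≠ (b, d₂) := by
      intro e he
      have hp2 : F.ends.Perm ((a, d₁) :: (b, d₂) :: (L ++ R)) := by
        rw [hE]
        exact List.perm_middle.trans (List.perm_middle.cons _)
      have := hp2.nodup_iff.1 hF.nodup
      simp only [List.nodup_cons, List.mem_cons, not_or] at this
      exact ⟨fun h => this.1.2 (h ▸ he), fun h => this.2.1 (h ▸ he)⟩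
    refine ⟨⟨hperm.nodup_iff.2 hF.nodup, ?_, ?_, ?_, ?_, ?_⟩, ?_⟩
    · simpa only [hperm.mem_iff] using hF.opposite
    · simpa only [hperm.mem_iff] using fun e he => (hF.name_lt e he).trans k.lt_succ_self
    · have aux : ∀ (word : ℕ → GaussCode) (a : ℕ) (d : Bool) (p : Pass) (n : ℕ), p.crossing = k →
          (∀ q ∈ word n, q.crossing ∈ insert k C) →
          ∀ q ∈ extend word a d p n, q.crossing ∈ insert k C := by
        intro word a d p n hp hn q hq
        unfold extend at hq
        by_cases hna : n = a
        · subst hna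
          rw [Function.update_self] at hq
          have : q ∈ word n ∨ q = p := by
            split_ifs at hq <;> simp at hq <;> tauto
          rcases this with h | rfl
          · exact hn q h
          · exact Set.mem_insert_iff.2 (Or.inl hp)
        · rw [Function.update_of_ne hna] at hq
          exact hn q hq
      intro e he
      rw [hperm.mem_iff] at he
      exact aux _ _ _ _ _ rfl (aux _ _ _ _ _ rfl fun q hq =>
        Set.mem_insert_of_mem _ (hF.word_mem e he q hq))
    · exact fun w hw p hp => Set.mem_insert_of_mem _ (hF.closed_mem w hw p hp)
    · intro c hc
      rcases Set.mem_insert_iff.1 hc with rfl | hc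
      · exact c.lt_succ_self
      · exact (hF.crossing_lt c hc).trans k.lt_succ_self
    · refine encard_le_of_rel (fun q q' => q.2.2 = q'.2.2 ∧ (∀ c, c ≠ k → q.1 c = q'.1 c) ∧
        ∃ L' x y x' y' R', L'.length = i ∧ q'.2.1 = L' ++ x :: y :: R' ∧
        q.2.1 = L' ++ y' :: x' :: R' ∧ colorStep actor q.1 ⟨k, o, s⟩ x x' ∧
        colorStep actor q.1 ⟨k, !o, s⟩ y y') ?_ ?_
      · rintro ⟨γ, cols, χ⟩ ⟨⟨κ, hκ, hcols⟩, hχ, hγ⟩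
        dsimp only at *
        obtain ⟨y, hy, h1⟩ := run_of_extend (R := colorStep actor γ)
          (fun p x y => colorStep_comm.1)
          (A := {n | ∃ d, (n, d) ∈ F.ends}) ⟨d₂, hbF⟩
          (fun n ⟨d, hn⟩ => hκ (n, d) (hperm.mem_iff.2 hn))
        obtain ⟨x, hx, h2⟩ := run_of_extend (R := colorStep actor γ)
          (fun p x y => colorStep_comm.1)
          (A := {n | ∃ d, (n, d) ∈ F.ends}) ⟨d₁, haF⟩ h1
        rw [Function.update_of_ne hne] at hx
        have hagree : ∀ w : GaussCode, (∀ p ∈ w, p.crossing ∈ C) →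
            ∀ {u v}, (Run (colorStep actor γ) w u v ↔
              Run (colorStep actor (Function.update γ k 0)) w u v) := fun w hw u v =>
          run_congr fun p hp => colorStep_congr rfl
            (by rw [Function.update_of_ne (show p.crossing ≠ k from fun h => hkC (h ▸ hw p hp))])
        have hsame : ∀ e ∈ L ++ R, κ e =
            Function.update (Function.update κ (b, d₂) y) (a, d₁) x e := fun e he => by
          rw [Function.update_of_ne (hLR e he).1, Function.update_of_ne (hLR e he).2]
        -- Above the slice the crossing `k` is unseen and has the default colour; the old words do
        -- not contain it, so their runs survive the change.
        refine ⟨(Function.update γ k 0,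
          F.ends.map (Function.update (Function.update κ (b, d₂) y) (a, d₁) x), χ),
          ⟨⟨_, fun e he => (hagree _ (hF.word_mem e he)).1 (h2 e.1 ⟨e.2, he⟩), rfl⟩, ?_, ?_⟩,
          rfl, fun c hc => by simp [hc],
          L.map κ, x, y, κ (a, d₁), κ (b, d₂), R.map κ, by simp [hlen], ?_, ?_, hx, hy⟩
        · exact ((List.forall₂_and_left _ _).2 ⟨hF.closed_mem, hχ⟩).imp
            fun w x h => (hagree w h.1).1 h.2
        · intro c hc
          by_cases hck : c = k
          · simp [hck]
          · simpa [hck] using hγ c (by simp [hck, hc])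
        · rw [List.map_congr_left fun e he => hsame e (List.mem_append_left _ he),
            List.map_congr_left (l := R) fun e he => hsame e (List.mem_append_right _ he), hE]
          simp [hne.symm]
        · rw [hcols]
          simp
      · rintro ⟨γ, cols, χ⟩ - ⟨γ', cols', χ'⟩ - ⟨γ'', cols'', χ''⟩
          ⟨h1, h2, L₁, x₁, y₁, x₁', y₁', R₁, h3, h4, h5, h6, h7⟩
          ⟨h1', h2', L₂, x₂, y₂, x₂', y₂', R₂, h3', h4', h5', h6', h7'⟩
        dsimp only at *
        obtain ⟨rfl, h8⟩ := List.append_inj (h4.symm.trans h4') (h3.trans h3'.symm)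
        simp only [List.cons.injEq] at h8
        obtain ⟨rfl, rfl, rfl⟩ := h8
        have hk : γ k = γ' k ∧ x₁' = x₂' ∧ y₁' = y₂' := by
          simp only [colorStep] at h6 h7 h6' h7'
          generalize actor k = A at *
          cases o <;> cases A <;> simp at h6 h7 h6' h7' <;> simp [h6, h7, h6', h7'] <;> grind
        have hγ : γ = γ' := funext fun c => by
          by_cases hc : c = k
          · rw [hc, hk.1]
          · rw [h2 c hc, h2' c hc]
        rw [hγ, h1, h1', h5, h5', hk.2.1, hk.2.2]
  · simp at h

/-- A local minimum asks its two strands to have equal colours and then drops them, so the colouring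
above determines the one below. When a component closes, the dropped colour becomes its base colour.
-/
theorem Front.join_isSound_and_encard_le (hF : F.IsSound k C) {a b : ℕ} {L R : List (ℕ × Bool)}
    {e₁ e₂ : ℕ × Bool} (hE : F.ends = L ++ e₁ :: e₂ :: R) (hlen : L.length = i)
    (he : (e₁ = (a, true) ∧ e₂ = (b, false)) ∨ (e₁ = (b, false) ∧ e₂ = (a, true))) :
    (F.join a b (L ++ R)).IsSound (k + 1) C ∧
      ((F.join a b (L ++ R)).colorings actor C).encard ≤ (F.colorings actor C).encard := by
  have hperm : F.ends.Perm ((a, true) :: (b, false) :: (L ++ R)) := by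
    rw [hE]
    refine (List.perm_middle.trans (List.perm_middle.cons _)).trans ?_
    rcases he with ⟨rfl, rfl⟩ | ⟨rfl, rfl⟩
    · rfl
    · exact List.Perm.swap _ _ _
  have hnodup := hperm.nodup_iff.1 hF.nodup
  simp only [List.nodup_cons, List.mem_cons, not_or] at hnodup
  obtain ⟨⟨-, haL⟩, hbL, hLR⟩ := hnodup
  have haF : (a, true) ∈ F.ends := hperm.mem_iff.2 (by simp)
  have hbF : (b, false) ∈ F.ends := hperm.mem_iff.2 (by simp)
  have hrest : ∀ e ∈ L ++ R, e ∈ F.ends := fun e h => hperm.mem_iff.2 (by simp [h])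
  have hmem : ∀ e ∈ F.ends, e ≠ (a, true) → e ≠ (b, false) → e ∈ L ++ R := by
    intro e h h1 h2
    simpa [h1, h2] using hperm.mem_iff.1 h
  have hcols : ∀ κ : ℕ × Bool → ZMod 3, κ (a, true) = κ (b, false) → F.ends.map κ =
      L.map κ ++ κ (a, true) :: κ (a, true) :: R.map κ := by
    intro κ h
    rw [hE]
    rcases he with ⟨rfl, rfl⟩ | ⟨rfl, rfl⟩ <;> simp [h]
  have rel_inj : ∀ {q q' r : (ℕ → ZMod 3) × List (ZMod 3) × List (ZMod 3)},
      (∃ L' x R', L'.length = i ∧ r.2.1 = L' ++ x :: x :: R' ∧ q.2.1 = L' ++ R' ∧ q.1 = r.1 ∧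
        q.2.2 = if a = b then x :: r.2.2 else r.2.2) →
      (∃ L' x R', L'.length = i ∧ r.2.1 = L' ++ x :: x :: R' ∧ q'.2.1 = L' ++ R' ∧ q'.1 = r.1 ∧
        q'.2.2 = if a = b then x :: r.2.2 else r.2.2) → q = q' := by
    rintro ⟨γ, cols, χ⟩ ⟨γ', cols', χ'⟩ ⟨γ'', cols'', χ''⟩ ⟨L₁, x₁, R₁, h1, h2, h3, h4, h5⟩
      ⟨L₂, x₂, R₂, h1', h2', h3', h4', h5'⟩
    dsimp only at *
    obtain ⟨rfl, h6⟩ := List.append_inj (h2.symm.trans h2') (h1.trans h1'.symm)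
    simp only [List.cons.injEq] at h6
    obtain ⟨rfl, -, rfl⟩ := h6
    rw [h3, h3', h4, h4', h5, h5']
  by_cases hab : a = b
  · subst hab
    have hne : ∀ e ∈ L ++ R, e.1 ≠ a := by
      rintro ⟨n, d⟩ h (rfl : n = a)
      cases d
      · exact hbL h
      · exact haL h
    simp only [Front.join, if_true]
    refine ⟨⟨hLR, ?_, fun e h => (hF.name_lt e (hrest e h)).trans k.lt_succ_self,
      fun e h => hF.word_mem e (hrest e h), ?_, fun c hc => (hF.crossing_lt c hc).trans
        k.lt_succ_self⟩, ?_⟩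
    · intro n d h
      have hn : n ≠ a := hne _ h
      exact hmem _ (hF.opposite n d (hrest _ h)) (by simp [hn]) (by simp [hn])
    · intro w hw
      rcases List.mem_cons.1 hw with rfl | hw
      · exact hF.word_mem _ haF
      · exact hF.closed_mem w hw
    · refine encard_le_of_rel (fun q r => ∃ L' x R', L'.length = i ∧ r.2.1 = L' ++ x :: x :: R' ∧
        q.2.1 = L' ++ R' ∧ q.1 = r.1 ∧ q.2.2 = if a = a then x :: r.2.2 else r.2.2) ?_
        fun q _ q' _ r h h' => rel_inj h h'
      rintro ⟨γ, cols, χ⟩ ⟨⟨κ, hκ, hc⟩, hχ, hγ⟩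
      dsimp only at *
      obtain ⟨x, χ₀, hx, hχ₀, rfl⟩ := List.forall₂_cons_left_iff.1 hχ
      set κ' := Function.update (Function.update κ (a, true) x) (a, false) x with hκ'
      have ht : κ' (a, true) = x := by simp [hκ']
      have hf : κ' (a, false) = x := by simp [hκ']
      have hsame : ∀ n d, n ≠ a → κ' (n, d) = κ (n, d) := fun n d hn => by simp [hκ', hn]
      refine ⟨(γ, F.ends.map κ', χ₀), ⟨⟨κ', fun e h => ?_, rfl⟩, hχ₀, hγ⟩,
        L.map κ', x, R.map κ', by simp [hlen], ?_, ?_, rfl, by simp⟩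
      · obtain ⟨n, d⟩ := e
        by_cases hn : n = a
        · subst hn
          rw [ht, hf]
          exact hx
        · rw [hsame n _ hn, hsame n _ hn]
          exact hκ _ (hmem _ h (by simp [hn]) (by simp [hn]))
      · dsimp only
        rw [hcols κ' (ht.trans hf.symm), ht]
      · rw [hc, ← List.map_append]
        exact List.map_congr_left fun e h => (hsame e.1 e.2 (hne e h)).symm
  · have hba : b ≠ a := fun h => hab h.symm
    simp only [Front.join, if_neg hab]
    set ren : ℕ × Bool → ℕ × Bool := fun e => if e.1 = b then (a, e.2) else e with hren
    have ren_b : ∀ d, ren (b, d) = (a, d) := fun d => by simp [hren]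
    have ren_ne : ∀ n d, n ≠ b → ren (n, d) = (n, d) := fun n d h => by simp [hren, h]
    have haG : (a, false) ∈ L ++ R :=
      hmem _ (hF.opposite a true haF) (by simp) (by simp [hab])
    have hbG : (b, true) ∈ L ++ R :=
      hmem _ (hF.opposite b false hbF) (by simp [hba]) (by simp)
    have hcases : ∀ e ∈ L ++ R, e = (b, true) ∨ e = (a, false) ∨ e.1 ≠ a ∧ e.1 ≠ b := by
      rintro ⟨n, d⟩ h
      by_cases hn : n = b
      · subst hn
        cases d
        · exact absurd h hbL
        · exact Or.inl rfl
      by_cases hn' : n = a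
      · subst hn'
        cases d
        · exact Or.inr (Or.inl rfl)
        · exact absurd h haL
      exact Or.inr (Or.inr ⟨hn', hn⟩)
    refine ⟨⟨?_, ?_, ?_, ?_, hF.closed_mem, fun c hc => (hF.crossing_lt c hc).trans
        k.lt_succ_self⟩, ?_⟩
    · refine hLR.map_on fun e h e' h' hee => ?_
      rcases hcases e h with rfl | rfl | ⟨h1, h2⟩ <;> rcases hcases e' h' with rfl | rfl | ⟨h3, h4⟩
      · rfl
      · rw [ren_b, ren_ne _ _ hab] at hee; simp at hee
      · rw [ren_b, ren_ne _ _ h4] at hee; exact absurd (congrArg Prod.fst hee).symm h3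
      · rw [ren_b, ren_ne _ _ hab] at hee; simp at hee
      · rfl
      · rw [ren_ne _ _ hab, ren_ne _ _ h4] at hee; exact hee
      · rw [ren_b, ren_ne _ _ h2] at hee; exact absurd (congrArg Prod.fst hee) h1
      · rw [ren_ne _ _ hab, ren_ne _ _ h2] at hee; exact hee
      · rw [ren_ne _ _ h2, ren_ne _ _ h4] at hee; exact hee
    · intro n d h
      obtain ⟨⟨n', d'⟩, hm, hee⟩ := List.mem_map.1 h
      rcases hcases _ hm with he | he | ⟨h1, h2⟩
      · rw [he, ren_b] at hee
        obtain ⟨rfl, rfl⟩ := Prod.mk.inj hee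
        exact List.mem_map.2 ⟨_, haG, ren_ne _ _ hab⟩
      · rw [he, ren_ne _ _ hab] at hee
        obtain ⟨rfl, rfl⟩ := Prod.mk.inj hee
        exact List.mem_map.2 ⟨_, hbG, ren_b _⟩
      · rw [ren_ne _ _ h2] at hee
        obtain ⟨rfl, rfl⟩ := Prod.mk.inj hee
        exact List.mem_map.2 ⟨_, hmem _ (hF.opposite n' d' (hrest _ hm))
          (fun h => h1 (congrArg Prod.fst h)) (fun h => h2 (congrArg Prod.fst h)), ren_ne _ _ h2⟩
    · intro e' h
      obtain ⟨e, hm, rfl⟩ := List.mem_map.1 h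
      rcases hcases e hm with rfl | rfl | ⟨h1, h2⟩
      · rw [ren_b]
        exact (hF.name_lt _ haF).trans k.lt_succ_self
      · rw [ren_ne _ _ hab]
        exact (hF.name_lt _ haF).trans k.lt_succ_self
      · rw [ren_ne _ _ h2]
        exact (hF.name_lt _ (hrest _ hm)).trans k.lt_succ_self
    · have haword : ∀ p ∈ F.word a ++ F.word b, p.crossing ∈ C := by
        intro p hp
        rcases List.mem_append.1 hp with hp | hp
        · exact hF.word_mem _ haF p hp
        · exact hF.word_mem _ hbF p hp
      intro e' h
      obtain ⟨e, hm, rfl⟩ := List.mem_map.1 h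
      dsimp only
      rcases hcases e hm with rfl | rfl | ⟨h1, h2⟩
      · rw [ren_b, Function.update_self]
        exact haword
      · rw [ren_ne _ _ hab, Function.update_self]
        exact haword
      · rw [ren_ne _ _ h2, Function.update_of_ne h1]
        exact hF.word_mem _ (hrest _ hm)
    · refine encard_le_of_rel (fun q r => ∃ L' x R', L'.length = i ∧ r.2.1 = L' ++ x :: x :: R' ∧
        q.2.1 = L' ++ R' ∧ q.1 = r.1 ∧ q.2.2 = if a = b then x :: r.2.2 else r.2.2) ?_
        fun q _ q' _ r h h' => rel_inj h h'
      rintro ⟨γ, cols, χ⟩ ⟨⟨κ, hκ, hc⟩, hχ, hγ⟩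
      dsimp only at *
      have hrun := hκ (a, false) (List.mem_map.2 ⟨_, haG, ren_ne _ _ hab⟩)
      rw [Function.update_self] at hrun
      obtain ⟨z, hz, hz'⟩ := run_append.1 hrun
      -- The joint between the two words gets the colour `z`; the terminal end of `b` carries the
      -- colour of the terminal end of the joined arc, which is named `a`.
      set κ' := Function.update (Function.update (Function.update κ (b, true) (κ (a, true)))
        (a, true) z) (b, false) z with hκ'
      have hat : κ' (a, true) = z := by simp [hκ']
      have hbf : κ' (b, false) = z := by simp [hκ']
      have hbt : κ' (b, true) = κ (a, true) := by simp [hκ', hba]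
      have haf : κ' (a, false) = κ (a, false) := by simp [hκ', hab]
      have hsame : ∀ n d, n ≠ a → n ≠ b → κ' (n, d) = κ (n, d) := fun n d hn hn' => by
        simp [hκ', hn, hn']
      refine ⟨(γ, F.ends.map κ', χ), ⟨⟨κ', fun e h => ?_, rfl⟩, hχ, hγ⟩,
        L.map κ', z, R.map κ', by simp [hlen], ?_, ?_, rfl, by simp [hab]⟩
      · obtain ⟨n, d⟩ := e
        by_cases hn : n = a
        · subst hn
          rw [hat, haf]
          exact hz
        by_cases hn' : n = b
        · subst hn'
          rw [hbf, hbt]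
          exact hz'
        rw [hsame n _ hn hn', hsame n _ hn hn']
        have h4 := hκ (n, d) (List.mem_map.2 ⟨_, hmem _ h (by simp [hn]) (by simp [hn']),
          ren_ne _ _ hn'⟩)
        rwa [Function.update_of_ne (show (n, d).1 ≠ a from hn)] at h4
      · dsimp only
        rw [hcols κ' (hat.trans hbf.symm), hat]
      · rw [hc, ← List.map_append, List.map_map]
        refine List.map_congr_left fun e h => ?_
        rw [Function.comp_apply]
        rcases hcases e h with rfl | rfl | ⟨h1, h2⟩
        · rw [ren_b, hbt]
        · rw [ren_ne _ _ hab, haf]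
        · rw [ren_ne _ _ h2, hsame _ _ h1 h2]

theorem Front.step_isSound_and_encard_le (hF : F.IsSound k C) {s : Slice}
    (h : F.step k s = some G) : ∃ C', G.IsSound (k + 1) C' ∧ (G.colorings actor C').encard ≤
      3 ^ (if s.isLocalMax then 1 else 0) * (F.colorings actor C).encard := by
  cases s with
  | localMax i d =>
    obtain ⟨h1, h2⟩ := Front.step_localMax (actor := actor) hF h
    exact ⟨C, h1, by simpa [Slice.isLocalMax] using h2⟩
  | virtual i =>
    obtain ⟨h1, h2⟩ := Front.step_virtual (actor := actor) hF h
    exact ⟨C, h1, by simpa [Slice.isLocalMax] using h2⟩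
  | classical i o =>
    obtain ⟨h1, h2⟩ := Front.step_classical (actor := actor) hF h
    exact ⟨_, h1, by simpa [Slice.isLocalMax] using h2⟩
  | localMin i =>
    simp only [Slice.isLocalMax, Bool.false_eq_true, if_false, pow_zero, one_mul]
    refine ⟨C, ?_⟩
    simp only [Front.step] at h
    split at h
    · rename_i a b R hdrop
      obtain ⟨hE, hlen⟩ := eq_take_append_of_drop_eq hdrop
      obtain rfl := Option.some.inj h
      exact Front.join_isSound_and_encard_le hF hE hlen (Or.inl ⟨rfl, rfl⟩)
    · rename_i b a R hdrop
      obtain ⟨hE, hlen⟩ := eq_take_append_of_drop_eq hdrop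
      obtain rfl := Option.some.inj h
      exact Front.join_isSound_and_encard_le hF hE hlen (Or.inr ⟨rfl, rfl⟩)
    · simp at h

theorem Front.sweep_isSound_and_encard_le {S : List Slice} (hF : F.IsSound k C)
    (h : Front.sweep k F S = some G) : ∃ k' C', G.IsSound k' C' ∧
      (G.colorings actor C').encard ≤
        3 ^ S.countP Slice.isLocalMax * (F.colorings actor C).encard := by
  induction S generalizing k F C with
  | nil =>
    obtain rfl := Option.some.inj h
    exact ⟨k, C, hF, by simp⟩
  | cons s S ih =>
    obtain ⟨F', h1, h2⟩ := Option.bind_eq_some_iff.1 h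
    obtain ⟨C₁, hF', hle⟩ := Front.step_isSound_and_encard_le (actor := actor) hF h1
    obtain ⟨k', C', hG, hle'⟩ := ih hF' h2
    refine ⟨k', C', hG, hle'.trans ?_⟩
    rw [List.countP_cons, pow_add, mul_assoc]
    exact mul_le_mul_right hle _

/-- The sweep starts from the single colouring of the empty front and ends with the closed word. No
condition on `actor` is needed, so the bound applies to the rule by indices. -/
theorem KnotDiagram.encard_colorings_le (D : KnotDiagram) (actor : ℕ → Bool) :
    (VirtualKnotTheory.colorings actor D.code).encard ≤ 3 ^ D.numLocalMax := by
  obtain ⟨F, hF, hends, hclosed⟩ := D.isKnot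
  have h0 : Front.empty.IsSound 0 ∅ := by
    constructor <;> simp [Front.empty]
  obtain ⟨k, C, hs, hle⟩ := Front.sweep_isSound_and_encard_le (actor := actor) h0 hF
  have h1 : (Front.empty.colorings actor ∅).encard ≤ 1 := by
    rw [Set.encard_le_one_iff]
    rintro ⟨γ, cols, χ⟩ ⟨γ', cols', χ'⟩ ⟨⟨κ, -, h1⟩, h2, h3⟩ ⟨⟨κ', -, h1'⟩, h2', h3'⟩
    simp only [Front.empty, List.map_nil, List.forall₂_nil_left_iff] at h1 h1' h2 h2'
    rw [h1, h1', h2, h2',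
      show γ = γ' from funext fun c => (h3 c (by simp)).trans (h3' c (by simp)).symm]
  calc (VirtualKnotTheory.colorings actor D.code).encard ≤ (F.colorings actor C).encard := by
        refine encard_le_of_rel (fun q o => o.1 = q.2 ∧ o.2.2 = [q.1]) ?_ ?_
        · rintro ⟨x, γ⟩ ⟨hr, h0⟩
          refine ⟨(γ, [], [x]), ⟨⟨fun _ => 0, by simp [hends], by simp [hends]⟩, ?_, fun c hc => ?_⟩,
            rfl, rfl⟩
          · rw [hclosed]
            exact List.Forall₂.cons hr .nil
          · refine h0 c fun p hp hpc => hc ?_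
            rw [← hpc]
            exact hs.closed_mem D.code (by simp [hclosed]) p hp
        · rintro ⟨x, γ⟩ - ⟨x', γ'⟩ - ⟨η, cols, χ⟩ ⟨h1, h2⟩ ⟨h3, h4⟩
          dsimp only at *
          rw [← h1, ← h3, List.singleton_inj.1 (h2.symm.trans h4)]
    _ ≤ 3 ^ D.numLocalMax * (Front.empty.colorings actor ∅).encard := hle
    _ ≤ 3 ^ D.numLocalMax * 1 := mul_le_mul_right h1 _
    _ = 3 ^ D.numLocalMax := mul_one _

end Sweep

/-! ### The two patterns on an arc and their Gauss words. -/

theorem Front.sweep_append {k : ℕ} {F : Front} {S S' : List Slice} :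
    Front.sweep k F (S ++ S') =
      (Front.sweep k F S).bind fun G => Front.sweep (k + S.length) G S' := by
  induction S generalizing k F with
  | nil => simp [Front.sweep]
  | cons s S ih =>
    simp only [List.cons_append, Front.sweep, List.length_cons]
    rw [Option.bind_assoc]
    congr 1
    funext G
    rw [ih, Nat.add_assoc, Nat.add_comm 1]

/-- The front consists of a single arc, with Gauss word `w`, whose left strand is oriented
upwards. -/
structure Front.IsArc (F : Front) (k : ℕ) (w : GaussCode) : Prop where
  closed : F.closed = []
  exists_name : ∃ a < k, F.ends = [(a, false), (a, true)] ∧ F.word a = w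

/-- A pattern on an arc with one additional local maximum, all of whose over passages
are on the right strand. -/
def overSlices : List Slice :=
  [.localMax 1 false, .classical 0 false, .virtual 2, .virtual 1, .classical 1 true, .virtual 1,
    .classical 2 false, .virtual 2, .virtual 1, .classical 0 true, .localMin 1]

/-- The passages on the left strand of `overSlices`. -/
def overLeft (k : ℕ) : GaussCode :=
  [⟨k + 9, false, -1⟩, ⟨k + 6, false, -1⟩, ⟨k + 4, false, 1⟩, ⟨k + 1, false, 1⟩]

/-- The passages on the right strand of `overSlices`. -/
def overRight (k : ℕ) : GaussCode :=
  [⟨k + 4, true, 1⟩, ⟨k + 9, true, -1⟩, ⟨k + 1, true, 1⟩, ⟨k + 6, true, -1⟩]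

/-- A pattern on an arc with one additional local maximum. Like the sum with a trefoil knot, it adds
one maximal overpass and one dimension of Fox `3`-colourings. -/
def trefoilSlices : List Slice :=
  [.localMax 1 true, .classical 2 false, .virtual 1, .classical 2 true, .virtual 2, .virtual 1,
    .classical 0 false, .virtual 1, .classical 1 true, .localMin 0, .virtual 0]

/-- The passages on the left strand of `trefoilSlices`. -/
def trefoilLeft (k : ℕ) : GaussCode :=
  [⟨k + 3, false, 1⟩, ⟨k + 1, false, -1⟩, ⟨k + 3, true, 1⟩, ⟨k + 6, true, -1⟩,
    ⟨k + 8, false, 1⟩, ⟨k + 6, false, -1⟩]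

/-- The passages on the right strand of `trefoilSlices`. -/
def trefoilRight (k : ℕ) : GaussCode := [⟨k + 1, true, -1⟩, ⟨k + 8, true, 1⟩]

variable {F : Front} {k : ℕ} {w : GaussCode}

theorem Front.IsArc.sweep_overSlices (h : F.IsArc k w) : ∃ G,
    Front.sweep k F overSlices = some G ∧ G.IsArc (k + 11) (overLeft k ++ w ++ overRight k) := by
  obtain ⟨ends, word, closed⟩ := F
  obtain ⟨rfl, a, hak, rfl, rfl⟩ := h
  have h1 : a ≠ k := hak.ne
  have h2 : k ≠ a := hak.ne'
  refine ⟨_, by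
    simp [overSlices, Front.sweep, Front.step, Front.join, extend, crossingSign, h1, h2]
    rfl, rfl, a, by omega, ?_, ?_⟩
  · simp
  · simp [overLeft, overRight]

theorem Front.IsArc.sweep_trefoilSlices (h : F.IsArc k w) : ∃ G,
    Front.sweep k F trefoilSlices = some G ∧
      G.IsArc (k + 11) (trefoilLeft k ++ w ++ trefoilRight k) := by
  obtain ⟨ends, word, closed⟩ := F
  obtain ⟨rfl, a, hak, rfl, rfl⟩ := h
  have h1 : a ≠ k := hak.ne
  have h2 : k ≠ a := hak.ne'
  refine ⟨_, by
    simp [trefoilSlices, Front.sweep, Front.step, Front.join, extend, crossingSign, h1, h2]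
    rfl, rfl, k, by omega, ?_, ?_⟩
  · simp
  · simp [trefoilLeft, trefoilRight]

/-! ### Levels and colourings of the patterns. -/

/-- Both sides of the pattern lead from `x` back to `x`, so a colouring of `w` survives between
them. The parameter `q` is the extra colour inside the pattern, `η` gives the acting colours, and
`q` can be read off at `c₀`. -/
theorem mul_encard_colorings_le {actor : ℕ → Bool} {k : ℕ} {u v w : GaussCode}
    (hw : ∀ p ∈ w, p.crossing < k) (Q : Set (ZMod 3)) (η : ZMod 3 → ZMod 3 → ℕ → ZMod 3)
    (hη : ∀ x q c, Fresh c u → η x q c = 0) {c₀ : ℕ} (hc₀ : k ≤ c₀)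
    (hinj : ∀ x, Q.InjOn fun q => η x q c₀)
    (hrun : ∀ x, ∀ q ∈ Q, ∀ γ : ℕ → ZMod 3, (∀ j, γ (k + j) = η x q (k + j)) →
      Run (colorStep actor γ) u x x ∧ Run (colorStep actor γ) v x x) :
    Q.encard * (colorings actor w).encard ≤ (colorings actor (u ++ w ++ v)).encard := by
  rw [← Set.encard_prod]
  have hfresh : ∀ c, k ≤ c → Fresh c w := fun c hc p hp => ((hw p hp).trans_le hc).ne
  refine Set.encard_le_encard_of_injOn
    (f := fun q => (q.2.1, fun c => if c < k then q.2.2 c else η q.2.1 q.1 c)) ?_ ?_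
  · rintro ⟨q, x, γ⟩ ⟨hq, h, h0⟩
    obtain ⟨h1, h2⟩ := hrun x q hq (fun c => if c < k then γ c else η x q c) (by simp)
    refine ⟨run_append.2 ⟨x, run_append.2 ⟨x, h1, ?_⟩, h2⟩, fun c hc => ?_⟩
    · exact (run_congr fun p hp => colorStep_congr rfl (by simp [hw p hp])).1 h
    · simp only [fresh_append] at hc
      dsimp only
      split_ifs
      · exact h0 c hc.1.2
      · exact hη _ _ _ hc.1.1
  · rintro ⟨q, x, γ⟩ ⟨hq, -, h0⟩ ⟨q', x', γ'⟩ ⟨hq', -, h0'⟩ h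
    obtain ⟨rfl, h⟩ := Prod.mk.inj h
    have hqq : q = q' := hinj x hq hq' (by simpa [not_lt.2 hc₀] using congrFun h c₀)
    have hγ : γ = γ' := funext fun c => by
      by_cases hc : c < k
      · simpa [hc] using congrFun h c
      · exact (h0 c (hfresh c (not_lt.1 hc))).trans (h0' c (hfresh c (not_lt.1 hc))).symm
    rw [hqq, hγ]

/-- The long word `w` returns to its level, and has at least `N` colourings for the rule `P`. -/
def IsBalanced (P : ℤ → Bool) (N : ℕ∞) (w : GaussCode) : Prop :=
  ∃ ho hu, Run (levelStep ho hu) w 0 0 ∧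
    N ≤ (colorings (fun c => P (hu c - ho c)) w).encard

theorem IsBalanced.attains {P : ℤ → Bool} {N : ℕ∞} {w : GaussCode} (h : IsBalanced P N w)
    (hw : IsPaired w) : Attains P N w := by
  obtain ⟨ho, hu, hr, hN⟩ := h
  exact ⟨hw, fun c => hu c - ho c, ⟨ho, hu, 0, hr, fun _ => rfl⟩, hN⟩

/-- Each side returns to level `0`, so the levels, indices and acting strands of `w` are unaffected.
The levels `eo`, `eu` of the new crossings are numbered from `k`. -/
theorem IsBalanced.extend {P : ℤ → Bool} {N : ℕ∞} {k : ℕ} {u v w : GaussCode}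
    (h : IsBalanced P N w) (hw : ∀ p ∈ w, p.crossing < k) (eo eu : ℕ → ℤ)
    (hlev : ∀ ho hu : ℕ → ℤ, (∀ j, ho (k + j) = eo j) → (∀ j, hu (k + j) = eu j) →
      Run (levelStep ho hu) u 0 0 ∧ Run (levelStep ho hu) v 0 0)
    (Q : Set (ZMod 3)) (η : ZMod 3 → ZMod 3 → ℕ → ZMod 3)
    (hη : ∀ x q c, Fresh c u → η x q c = 0) {c₀ : ℕ} (hc₀ : k ≤ c₀)
    (hinj : ∀ x, Q.InjOn fun q => η x q c₀)
    (hrun : ∀ x, ∀ q ∈ Q, ∀ γ : ℕ → ZMod 3, (∀ j, γ (k + j) = η x q (k + j)) →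
      ∀ actor : ℕ → Bool, (∀ j, actor (k + j) = P (eu j - eo j)) →
      Run (colorStep actor γ) u x x ∧ Run (colorStep actor γ) v x x) :
    IsBalanced P (Q.encard * N) (u ++ w ++ v) := by
  obtain ⟨ho, hu, hr, hN⟩ := h
  let ho' : ℕ → ℤ := fun c => if c < k then ho c else eo (c - k)
  let hu' : ℕ → ℤ := fun c => if c < k then hu c else eu (c - k)
  have ho_add : ∀ j, ho' (k + j) = eo j := by simp [ho']
  have hu_add : ∀ j, hu' (k + j) = eu j := by simp [hu']
  obtain ⟨h1, h2⟩ := hlev ho' hu' ho_add hu_add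
  refine ⟨ho', hu', run_append.2 ⟨0, run_append.2 ⟨0, h1, ?_⟩, h2⟩, ?_⟩
  · exact (run_congr fun p hp =>
      levelStep_congr (by simp [ho', hw p hp]) (by simp [hu', hw p hp])).1 hr
  · refine le_trans ?_ (mul_encard_colorings_le hw Q η hη hc₀ hinj fun x q hq γ hγ =>
      hrun x q hq γ hγ _ fun j => by rw [ho_add, hu_add])
    rw [colorings_congr (actor' := fun c => P (hu c - ho c))]
    · exact mul_le_mul_right hN _
    · intro p hp
      simp [ho', hu', hw p hp]

theorem encard_univ_zmod_three : (Set.univ : Set (ZMod 3)).encard = 3 := by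
  rw [Set.encard_univ, ENat.card_eq_coe_fintype_card, ZMod.card]
  rfl

section Patterns

variable {P : ℤ → Bool} {N : ℕ∞} {k : ℕ} {w : GaussCode}

/-- These levels give index `0` at `k + 1` and `k + 9`, and index `1` at `k + 4` and `k + 6`. -/
theorem run_levelStep_over {ho hu : ℕ → ℤ}
    (h : ∀ j, ho (k + j) = if j = 4 ∨ j = 1 then 1 else 0)
    (h' : ∀ j, hu (k + j) = if j = 4 then 2 else if j = 6 ∨ j = 1 then 1 else 0) :
    Run (levelStep ho hu) (overLeft k) 0 0 ∧ Run (levelStep ho hu) (overRight k) 0 0 := by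
  simp [overLeft, overRight, run_cons, levelStep, h, h']

/-- The over strand acts at all four crossings, as their indices are nonnegative. Giving the whole
pattern the colour `x` extends each colouring. -/
theorem IsBalanced.over (h : IsBalanced P N w) (hw : ∀ p ∈ w, p.crossing < k)
    (hP : ∀ n, 0 ≤ n → P n = true) : IsBalanced P N (overLeft k ++ w ++ overRight k) := by
  rw [← one_mul N, ← Set.encard_singleton (0 : ZMod 3)]
  refine h.extend hw (fun j => if j = 4 ∨ j = 1 then 1 else 0)
    (fun j => if j = 4 then 2 else if j = 6 ∨ j = 1 then 1 else 0)
    (fun ho hu h h' => run_levelStep_over h h') _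
    (fun x _ c => if c = k + 1 ∨ c = k + 4 ∨ c = k + 6 ∨ c = k + 9 then x else 0) ?_ le_rfl
    (fun x => Set.injOn_singleton _ _) ?_
  · intro x q c hc
    simp [Fresh, overLeft] at hc
    grind
  rintro x q - γ hγ actor hactor
  simp [overLeft, overRight, run_cons, colorStep, hγ, hactor, hP]

/-- The under strand acts at `k + 4` and `k + 6`, with a free colour `q`. Between them the right
strand has the colour `-q - x`; at `k + 9` and `k + 1` it turns the left strand from `x` to `q` and
back. -/
theorem IsBalanced.over_three (h : IsBalanced P N w) (hw : ∀ p ∈ w, p.crossing < k)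
    (h0 : P 0 = true) (h1 : P 1 = false) :
    IsBalanced P (3 * N) (overLeft k ++ w ++ overRight k) := by
  rw [← encard_univ_zmod_three]
  refine h.extend hw (fun j => if j = 4 ∨ j = 1 then 1 else 0)
    (fun j => if j = 4 then 2 else if j = 6 ∨ j = 1 then 1 else 0)
    (fun ho hu h h' => run_levelStep_over h h') _
    (fun x q c => if c = k + 4 ∨ c = k + 6 then q else
      if c = k + 1 ∨ c = k + 9 then -q - x else 0) ?_ (c₀ := k + 4) (by omega) ?_ ?_
  · intro x q c hc
    simp [Fresh, overLeft] at hc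
    grind
  · rintro x q - q' -
    simp
  rintro x q - γ hγ actor hactor
  simp [overLeft, overRight, run_cons, colorStep, hγ, hactor, h0, h1]

/-- The indices are `0` at `k + 1`, `k + 8` and `-1` at `k + 3`, `k + 6`, so the over strand always
acts. The left strand takes the colours `x`, `-q - x`, `q`, `-q - x`, `x`, where the free `q`
colours the new overpass; the right strand keeps `x`. -/
theorem IsBalanced.trefoil (h : IsBalanced P N w) (hw : ∀ p ∈ w, p.crossing < k)
    (h0 : P 0 = true) (h1 : P (-1) = true) :
    IsBalanced P (3 * N) (trefoilLeft k ++ w ++ trefoilRight k) := by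
  rw [← encard_univ_zmod_three]
  refine h.extend hw (fun j => if j = 3 then 1 else if j = 1 then -1 else 0)
    (fun j => if j = 1 ∨ j = 6 then -1 else 0) ?_ _
    (fun x q c => if c = k + 3 ∨ c = k + 6 then q else if c = k + 1 ∨ c = k + 8 then x else 0)
    ?_ (c₀ := k + 3) (by omega) ?_ ?_
  · intro ho hu h h'
    simp [trefoilLeft, trefoilRight, run_cons, levelStep, h, h']
  · intro x q c hc
    simp [Fresh, trefoilLeft] at hc
    grind
  · rintro x q - q' -
    simp
  rintro x q - γ hγ actor hactor
  simp [trefoilLeft, trefoilRight, run_cons, colorStep, hγ, hactor, h0, h1]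
  ring

theorem isPaired_over (hw : ∀ p ∈ w, p.crossing < k) (h : IsPaired w) :
    IsPaired (overLeft k ++ w ++ overRight k) := by
  have hf : ∀ j, Fresh (k + j) w := fun j p hp => by have := hw p hp; omega
  have h1 := (isPaired_pair (hf 1) true 1 1).2 h
  have h2 := (isPaired_pair (c := k + 4) (by simp [fresh_cons, hf]) true 1 1).2 h1
  have h3 := (isPaired_pair (c := k + 6) (by simp [fresh_cons, hf]) true (-1) (-1)).2 h2
  have h4 := (isPaired_pair (c := k + 9) (by simp [fresh_cons, hf]) true (-1) (-1)).2 h3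
  refine (isPaired_congr ?_).1 h4
  classical
  rw [List.perm_iff_count]
  intro p
  simp only [overLeft, overRight, List.count_append, List.count_cons, List.count_nil, Bool.not_true]
  omega

theorem isPaired_trefoil (hw : ∀ p ∈ w, p.crossing < k) (h : IsPaired w) :
    IsPaired (trefoilLeft k ++ w ++ trefoilRight k) := by
  have hf : ∀ j, Fresh (k + j) w := fun j p hp => by have := hw p hp; omega
  have h1 := (isPaired_pair (hf 1) true (-1) (-1)).2 h
  have h2 := (isPaired_pair (c := k + 3) (by simp [fresh_cons, hf]) true 1 1).2 h1
  have h3 := (isPaired_pair (c := k + 6) (by simp [fresh_cons, hf]) true (-1) (-1)).2 h2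
  have h4 := (isPaired_pair (c := k + 8) (by simp [fresh_cons, hf]) true 1 1).2 h3
  refine (isPaired_congr ?_).1 h4
  classical
  rw [List.perm_iff_count]
  intro p
  simp only [trefoilLeft, trefoilRight, List.count_append, List.count_cons, List.count_nil,
    Bool.not_true]
  omega

end Patterns

/-! ### Assembling the examples and comparing the bounds. -/

/-- The arcs from which the knots with bridge indices `t + 1` and `t + r + 1` are
obtained. -/
structure IsBridgeWord (t r k : ℕ) (w : GaussCode) : Prop where
  crossing_lt : ∀ p ∈ w, p.crossing < k
  isPaired : IsPaired w
  numOverpasses_eq : numOverpasses w = t + 1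
  ascents_eq : ascents false (w.map Pass.isOver ++ [true]) = t + 1
  isBalanced_fox : IsBalanced (fun _ => true) (3 ^ (t + 1)) w
  isBalanced_index : IsBalanced (fun n => decide (n ≤ 0)) (3 ^ (t + r + 1)) w

/-- The only freedom is the base colour. The bound `1` on names accounts for slice `0`, the opening
local maximum. -/
theorem isBridgeWord_nil : IsBridgeWord 0 0 1 [] := by
  have h : (3 : ℕ∞) ≤ (colorings (fun _ => true) []).encard := by
    rw [← encard_univ_zmod_three]
    refine Set.encard_le_encard_of_injOn (f := fun x => (x, 0)) (fun x _ => ⟨rfl, fun _ _ => rfl⟩) ?_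
    intro x _ y _ h
    exact congrArg Prod.fst h
  refine ⟨by simp, fun c => by simp, by simp [numOverpasses], by simp [ascents],
    ⟨0, 0, rfl, by simpa using h⟩, ⟨0, 0, rfl, by simpa using h⟩⟩

/-- The field `ascents_eq` counts overpasses with an under passage before the word and an over
passage after it, as both patterns provide. Here only under passages are put in front and only over
passages behind, so no overpass is added. -/
theorem IsBridgeWord.over {t r k : ℕ} {w : GaussCode} (h : IsBridgeWord t r k w) :
    IsBridgeWord t (r + 1) (k + 11) (overLeft k ++ w ++ overRight k) := by
  refine ⟨?_, isPaired_over h.crossing_lt h.isPaired, ?_, ?_,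
    h.isBalanced_fox.over h.crossing_lt fun _ _ => rfl, ?_⟩
  · intro p hp
    simp only [List.mem_append, or_assoc] at hp
    rcases hp with hp | hp | hp
    · simp [overLeft] at hp
      rcases hp with rfl | rfl | rfl | rfl <;> simp
    · exact (h.crossing_lt p hp).trans (by omega)
    · simp [overRight] at hp
      rcases hp with rfl | rfl | rfl | rfl <;> simp
  · have := h.ascents_eq
    simp only [overLeft, overRight, List.cons_append, numOverpasses_cons]
    simp [ascents, ascents_append_true, this]
  · have := h.ascents_eq
    simp [overLeft, overRight, ascents, ascents_append_true, this]
  · have := h.isBalanced_index.over_three h.crossing_lt (by simp) (by simp)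
    rwa [← pow_succ', show t + r + 1 + 1 = t + (r + 1) + 1 by omega] at this

/-- The two over passages in the middle of the left strand, between under passages, form the
additional overpass. -/
theorem IsBridgeWord.trefoil {t r k : ℕ} {w : GaussCode} (h : IsBridgeWord t r k w) :
    IsBridgeWord (t + 1) r (k + 11) (trefoilLeft k ++ w ++ trefoilRight k) := by
  refine ⟨?_, isPaired_trefoil h.crossing_lt h.isPaired, ?_, ?_, ?_, ?_⟩
  · intro p hp
    simp only [List.mem_append, or_assoc] at hp
    rcases hp with hp | hp | hp
    · simp [trefoilLeft] at hp
      rcases hp with rfl | rfl | rfl | rfl | rfl | rfl <;> simp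
    · exact (h.crossing_lt p hp).trans (by omega)
    · simp [trefoilRight] at hp
      rcases hp with rfl | rfl <;> simp
  · have := h.ascents_eq
    simp only [trefoilLeft, trefoilRight, List.cons_append, numOverpasses_cons]
    simp [ascents, ascents_append_true, this]
    omega
  · have := h.ascents_eq
    simp [trefoilLeft, trefoilRight, ascents, ascents_append_true, this]
    omega
  · have := h.isBalanced_fox.trefoil h.crossing_lt rfl rfl
    rwa [← pow_succ'] at this
  · have := h.isBalanced_index.trefoil h.crossing_lt (by simp) (by simp)
    rwa [← pow_succ', show t + r + 1 + 1 = t + 1 + r + 1 by omega] at this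

theorem exists_isBridgeWord (t r : ℕ) : ∃ S F w,
    Front.sweep 0 Front.empty S = some F ∧ F.IsArc S.length w ∧
    S.countP Slice.isLocalMax = t + r + 1 ∧ IsBridgeWord t r S.length w := by
  induction t with
  | zero =>
    induction r with
    | zero =>
      exact ⟨[.localMax 0 false], ⟨[(0, false), (0, true)], Function.update (fun _ => []) 0 [], []⟩, [],
        rfl, ⟨rfl, 0, by simp, rfl, by simp⟩, by simp [Slice.isLocalMax], isBridgeWord_nil⟩
    | succ r ih =>
      obtain ⟨S, F, w, h1, h2, h3, h4⟩ := ih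
      obtain ⟨G, h5, h6⟩ := h2.sweep_overSlices
      refine ⟨S ++ overSlices, G, _, ?_, by simpa [overSlices] using h6, ?_,
        by simpa [overSlices] using h4.over⟩
      · rw [Front.sweep_append, h1, Option.bind_some, Nat.zero_add, h5]
      · rw [List.countP_append, h3]
        rfl
  | succ t ih =>
    obtain ⟨S, F, w, h1, h2, h3, h4⟩ := ih
    obtain ⟨G, h5, h6⟩ := h2.sweep_trefoilSlices
    refine ⟨S ++ trefoilSlices, G, _, ?_, by simpa [trefoilSlices] using h6, ?_,
      by simpa [trefoilSlices] using h4.trefoil⟩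
    · rw [Front.sweep_append, h1, Option.bind_some, Nat.zero_add, h5]
    · rw [List.countP_append, h3, show trefoilSlices.countP Slice.isLocalMax = 1 from rfl]
      omega

theorem exists_bridge_diagram (t r : ℕ) : ∃ D : KnotDiagram, D.numLocalMax = t + r + 1 ∧
    numOverpasses D.code = t + 1 ∧ Attains (fun _ => true) (3 ^ (t + 1)) D.code ∧
    Attains (fun n => decide (n ≤ 0)) (3 ^ (t + r + 1)) D.code := by
  obtain ⟨S, F, w, h1, ⟨h2, a, -, h3, rfl⟩, h4, h5⟩ := exists_isBridgeWord t r
  refine ⟨⟨S ++ [.localMin 0], F.word a, ⟨[], F.word, [F.word a]⟩, ?_, rfl, rfl⟩, ?_,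
    h5.numOverpasses_eq, h5.isBalanced_fox.attains h5.isPaired,
    h5.isBalanced_index.attains h5.isPaired⟩
  · rw [Front.sweep_append, h1]
    simp [Front.sweep, Front.step, Front.join, h2, h3]
  · simp [KnotDiagram.numLocalMax, h4, Slice.isLocalMax]

theorem exists_bridge_indices (m n : ℕ) (hm : 1 ≤ m) (hmn : m ≤ n) :
    ∃ K : VirtualKnotTheory.VirtualKnot,
      K.firstBridgeIndex = m ∧ K.secondBridgeIndex = n := by
  obtain ⟨D, h1, h2, h3, h4⟩ := exists_bridge_diagram (m - 1) (n - m)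
  rw [show m - 1 + 1 = m by omega] at h2 h3
  rw [show m - 1 + (n - m) + 1 = n by omega] at h1 h4
  have pow_le : ∀ {a b : ℕ}, (3 : ℕ∞) ^ a ≤ 3 ^ b → a ≤ b := fun {a b} h => by
    have h' : (3 : ℕ) ^ a ≤ 3 ^ b := by exact_mod_cast h
    exact (Nat.pow_le_pow_iff_right (by norm_num)).1 h'
  refine ⟨Quotient.mk _ D, le_antisymm (Nat.sInf_le ⟨D, rfl, h2⟩) ?_,
    le_antisymm (Nat.sInf_le ⟨D, rfl, h1⟩) ?_⟩
  · refine le_csInf ⟨_, D, rfl, rfl⟩ ?_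
    rintro _ ⟨D', hD', rfl⟩
    have hequiv : Relation.EqvGen GaussMove D'.code D.code := Quotient.exact hD'
    -- Invariance also shows that the code of `D'` is paired, which the overpass bound needs.
    obtain ⟨hp, δ, -, hN⟩ := (attains_iff_of_eqvGen (fun _ _ _ => rfl) hequiv).2 h3
    exact pow_le (hN.trans (encard_colorings_le_numOverpasses hp))
  · refine le_csInf ⟨_, D, rfl, rfl⟩ ?_
    rintro _ ⟨D', hD', rfl⟩
    have hequiv : Relation.EqvGen GaussMove D'.code D.code := Quotient.exact hD'
    -- The rule `n ≤ 0` qualifies: sums of nonpositive integers are nonpositive, and sums of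
    -- positive ones are positive.
    obtain ⟨-, δ, -, hN⟩ := (attains_iff_of_eqvGen (fun p q h => by grind) hequiv).2 h4
    exact pow_le (hN.trans (D'.encard_colorings_le _))

end VirtualKnotTheory

theorem theorem1p1 (m n : ℕ) (hm : 1 ≤ m) (hmn : m ≤ n) :
    ∃ K : VirtualKnotTheory.VirtualKnot,
      K.firstBridgeIndex = m ∧ K.secondBridgeIndex = n :=
  VirtualKnotTheory.exists_bridge_indices m n hm hmn
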